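/- Proposition 2.2.3. Let $\Phi$ be an irreducible reduced crystallographic root system (the root system of a finite-dimensional complex simple Lie algebra) with a set of simple roots, $\Phi_+$ the positive roots, $Q^\vee=\sum_{\alpha\in\Phi}\mathbb{Z}\alpha^\vee$ the coroot lattice, $\mathfrak{h}_{\mathbb{R}}=\mathbb{R}\otimes_{\mathbb Z} Q^\vee$, and $W$ the Weyl group. Let $W_{\mathrm{af}}=W\ltimes Q^\vee$ be the affine Weyl group; write $t_\lambda$ for the translation by $\lambda\in Q^\vee$ and $w=\mathrm{cl}(w)\,t_{\mathrm{wt}(w)}$ with $\mathrm{cl}(w)\in W$, $\mathrm{wt}(w)\in Q^\vee$ for $w\in W_{\mathrm{af}}$. For $\alpha\in\Phi_+$ and $m\in\mathbb{Z}$ put $\mathcal F_{\alpha,m}=\{\mu\in\mathfrak h_{\mathbb R}\mid\langle\alpha,\mu\rangle=m\}$ and $\mathcal F^{\pm}_{\alpha,m}=\{\mu\in\mathfrak h_{\mathbb R}\mid \pm(\langle\alpha,\mu\rangle-m)>0\}$. Alcoves are the connected components of the complement in $\mathfrak{h}_{\mathbb R}$ of all the $\mathcal F_{\alpha,m}$;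 put $A^-=\{\mu\in\mathfrak h_{\mathbb R}\mid -1<\langle\alpha,\mu\rangle<0\text{ for all }\alpha\in\Phi_+\}$ and $A^-\cdot w=\mathrm{cl}(w)^{-1}A^-+\mathrm{wt}(w)$. For alcoves $A,B$ choose alcoves $A=A_0,A_1,\dots,A_r=B$ such that $A_{i-1}$ and $A_i$ have a unique common wall, contained in $\mathcal F_{\beta_i,m_i}$ say with $\beta_i\in\Phi_+$, and let $d(A,B)$ be the number of $i$ with $A_i\subset\mathcal F^{+}_{\beta_i,m_i}$ minus the number of $i$ with $A_i\subset\mathcal F^{-}_{\beta_i,m_i}$ (this is independent of the choice). For $y,w\in W_{\mathrm{af}}$ set $\ell^{\frac{\infty}{2}}(y,w)=d(A^-\cdot y,A^-\cdot w)$. Let $s_{\alpha+m\delta}=s_\alpha t_{m\alpha^\vee}$ be the reflection attached to the real affine root $\alpha+m\delta$ ($\alpha\in\Phi$, $m\in\mathbb Z$), which is positive if $\alpha\in\Phi_+$ and $m\ge 0$, or $-\alpha\in\Phi_+$ and $m>0$. The semi-infinite Bruhat order on $W_{\mathrm{af}}$ is defined by: $y\le_{\frac{\infty}{2}}w$ if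 there are $y=y_0,y_1,\dots,y_r=w$ in $W_{\mathrm{af}}$ such that, for each $1\le i\le r$, $y_i=y_{i-1}s_{\gamma_i}$ for some positive real affine root $\gamma_i$, and $\ell^{\frac{\infty}{2}}(y_{i-1},y_i)>0$. Let $y,w\in W_{\mathrm{af}}$ be such that $y\le_{\frac{\infty}{2}}w$ and $\ell^{\frac{\infty}{2}}(y,w)=2$. Then the number of elements $z\in W_{\mathrm{af}}$ satisfying $y<_{\frac{\infty}{2}}z<_{\frac{\infty}{2}}w$ is $1$ if $\mathrm{cl}(y)=\mathrm{cl}(w)$, and is $2$ if $\mathrm{cl}(y)\ne\mathrm{cl}(w)$. -/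

import Mathlib

namespace SemiInfinite

section

variable {ι M V : Type*}
  [AddCommGroup M] [Module ℝ M] [AddCommGroup V] [Module ℝ V]

/-- The hyperplane `F_{α,m} = {μ | ⟨α, μ⟩ = m}` for the root `α` with index `i`. -/
def hyperplane (P : RootPairing ι ℝ M V) (i : ι) (m : ℤ) : Set V :=
  {v | P.root' i v = m}

/-- The open half-space `F⁺_{α,m} = {μ | ⟨α, μ⟩ - m > 0}`. -/
def posHalf (P : RootPairing ι ℝ M V) (i : ι) (m : ℤ) : Set V :=
  {v | P.root' i v - m > 0}

/-- The open half-space `F⁻_{α,m} = {μ | -(⟨α, μ⟩ - m) > 0}`. -/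
def negHalf (P : RootPairing ι ℝ M V) (i : ι) (m : ℤ) : Set V :=
  {v | -(P.root' i v - m) > 0}

/-- The coroot lattice `Q^∨ = ∑ ℤ α^∨`. -/
def corootLattice (P : RootPairing ι ℝ M V) : AddSubgroup V :=
  AddSubgroup.closure (Set.range P.coroot)

/-- The affine Weyl group, as the group of affine transformations of the real span `V` of the
coroots that is generated by the reflections `s_α : v ↦ v - ⟨α, v⟩ α^∨` (which generate the
finite Weyl group) and the translations `t_lam : v ↦ v + lam` with `lam ∈ Q^∨`. -/
def affineWeylGroup (P : RootPairing ι ℝ M V) : Subgroup (V ≃ᵃ[ℝ] V) :=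
  Subgroup.closure
    (Set.range (fun i => (P.coreflection i).toAffineEquiv) ∪
      (fun lam : V => AffineEquiv.constVAdd ℝ V lam) '' (corootLattice P : Set V))

/-- The finite part `cl(w)` of `w = cl(w) t_{wt(w)}`: it is the linear part of `w`. -/
def cl {P : RootPairing ι ℝ M V} (w : affineWeylGroup P) : V ≃ₗ[ℝ] V :=
  (w : V ≃ᵃ[ℝ] V).linear

/-- The translation part `wt(w)` of `w = cl(w) t_{wt(w)}`, that is `cl(w)⁻¹ (w 0)`. -/
def wt {P : RootPairing ι ℝ M V} (w : affineWeylGroup P) : V :=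
  (cl w).symm ((w : V ≃ᵃ[ℝ] V) 0)

/-- The decomposition `w = cl(w) t_{wt(w)}`. -/
theorem eq_cl_mul_translation {P : RootPairing ι ℝ M V} (w : affineWeylGroup P) :
    (w : V ≃ᵃ[ℝ] V) = (cl w).toAffineEquiv * AffineEquiv.constVAdd ℝ V (wt w) := by
  ext v
  have h := (w : V ≃ᵃ[ℝ] V).map_vadd 0 v
  simp only [vadd_eq_add, add_zero] at h
  simp [cl, wt, h, add_comm]

/-- The reflection `s_{α + m δ} = s_α t_{m α^∨}` in the affine Weyl group, where `α` is the root
with index `i`. -/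
def affineReflection (P : RootPairing ι ℝ M V) (i : ι) (m : ℤ) : affineWeylGroup P :=
  ⟨(P.coreflection i).toAffineEquiv * AffineEquiv.constVAdd ℝ V (m • P.coroot i),
    (affineWeylGroup P).mul_mem
      (Subgroup.subset_closure (Or.inl ⟨i, rfl⟩))
      (Subgroup.subset_closure (Or.inr ⟨m • P.coroot i,
        (corootLattice P).zsmul_mem (AddSubgroup.subset_closure ⟨i, rfl⟩) m, rfl⟩))⟩

/-- `α + m δ`, with `α` the root with index `i`, is a positive real affine root: either `α` is
positive and `m ≥ 0`, or `α` is negative and `m > 0`. -/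
def IsPosAffineRoot {P : RootPairing ι ℝ M V} (b : P.Base) (i : ι) (m : ℤ) : Prop :=
  (b.IsPos i ∧ 0 ≤ m) ∨ (¬ b.IsPos i ∧ 0 < m)

/-- The alcove `A⁻ = {v | -1 < ⟨α, v⟩ < 0 for all positive roots α}`. -/
def baseAlcove {P : RootPairing ι ℝ M V} (b : P.Base) : Set V :=
  {v | ∀ i, b.IsPos i → -1 < P.root' i v ∧ P.root' i v < 0}

/-- The right action of the affine Weyl group on subsets of `V`, in particular on alcoves:
`A · w = cl(w)⁻¹ A + wt(w)`. -/
def rightAct {P : RootPairing ι ℝ M V} (A : Set V) (w : affineWeylGroup P) : Set V :=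
  (fun v => (cl w).symm v + wt w) '' A

variable [TopologicalSpace V]

/-- Alcoves: the connected components of the complement of all hyperplanes `F_{α,m}`. -/
def IsAlcove {P : RootPairing ι ℝ M V} (b : P.Base) (A : Set V) : Prop :=
  ∃ v ∈ {u : V | ∀ i, b.IsPos i → ∀ m : ℤ, u ∉ hyperplane P i m},
    A = connectedComponentIn {u : V | ∀ i, b.IsPos i → ∀ m : ℤ, u ∉ hyperplane P i m} v

/-- `S` is a wall of the alcove `A`: a closed face `F_{α,m} ∩ closure A` of codimension one, that
is, one whose affine span is all of `F_{α,m}`. -/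
def IsWall {P : RootPairing ι ℝ M V} (b : P.Base) (A S : Set V) : Prop :=
  ∃ i, b.IsPos i ∧ ∃ m : ℤ, S = hyperplane P i m ∩ closure A ∧
    (affineSpan ℝ S : Set V) = hyperplane P i m

/-- `A` and `B` are alcoves with a unique common wall, this wall lies in the hyperplane `F_{α,m}`
with `α` positive, and `A ⊆ F⁻_{α,m}`, `B ⊆ F⁺_{α,m}`. -/
def StepUp {P : RootPairing ι ℝ M V} (b : P.Base) (A B : Set V) : Prop :=
  IsAlcove b A ∧ IsAlcove b B ∧
    ∃ S, (IsWall b A S ∧ IsWall b B S) ∧ (∀ T, IsWall b A T ∧ IsWall b B T → T = S) ∧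
      ∃ i, b.IsPos i ∧ ∃ m : ℤ, S ⊆ hyperplane P i m ∧ A ⊆ negHalf P i m ∧ B ⊆ posHalf P i m

/-- `GalleryDist b A B n`: there is a gallery `A = A₀, …, A_r = B` of alcoves, consecutive ones
having a unique common wall, whose number of steps to the positive side of that wall minus the
number of steps to the negative side is `n`. -/
inductive GalleryDist {P : RootPairing ι ℝ M V} (b : P.Base) : Set V → Set V → ℤ → Prop
  | refl (A : Set V) (hA : IsAlcove b A) : GalleryDist b A A 0
  | up {A B C : Set V} {n : ℤ} (h : GalleryDist b A B n) (hBC : StepUp b B C) :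
      GalleryDist b A C (n + 1)
  | down {A B C : Set V} {n : ℤ} (h : GalleryDist b A B n) (hCB : StepUp b C B) :
      GalleryDist b A C (n - 1)

open Classical in
/-- The integer `d(A, B)`: the signed number of steps of a gallery of alcoves from `A` to `B`
(any two alcoves are joined by a gallery, and the number does not depend on it). -/
noncomputable def signedDist {P : RootPairing ι ℝ M V} (b : P.Base) (A B : Set V) : ℤ :=
  if h : ∃ n : ℤ, GalleryDist b A B n then h.choose else 0

/-- The difference `d(A⁻ · y, A⁻ · w)` of the semi-infinite lengths of `w` and `y`. -/
noncomputable def semiInfLength {P : RootPairing ι ℝ M V} (b : P.Base)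
    (y w : affineWeylGroup P) : ℤ :=
  signedDist b (rightAct (baseAlcove b) y) (rightAct (baseAlcove b) w)

/-- The semi-infinite Bruhat order: `y ≤ w` if there is a sequence `y = y₀, …, y_r = w` with
`y_k = y_{k-1} s_β` for a positive real affine root `β` and positive semi-infinite length
difference from `y_{k-1}` to `y_k`, for each `k`. -/
def semiInfLE {P : RootPairing ι ℝ M V} (b : P.Base) (y w : affineWeylGroup P) : Prop :=
  Relation.ReflTransGen
    (fun u v : affineWeylGroup P =>
      ∃ i, ∃ m : ℤ, IsPosAffineRoot b i m ∧ v = u * affineReflection P i m ∧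
        0 < semiInfLength b u v) y w

/-- The strict semi-infinite Bruhat order. -/
def semiInfLT {P : RootPairing ι ℝ M V} (b : P.Base) (y w : affineWeylGroup P) : Prop :=
  semiInfLE b y w ∧ y ≠ w

end

end SemiInfinite

/-! Let h(v) be the sum of ⌊⟨α, v⟩⌋ over the positive roots α (`floorSum`), for v off all
hyperplanes. Crossing a wall changes exactly one summand, by one, so d(A, B) is a difference of
values of h (`signedDist_cell`). Fix v₀ in A⁻. The semi-infinite length compares h at the points v₀
· w, and right multiplication by s_{α+mδ} reflects such a point in F_{α,m}
(`act_mul_affineReflection`).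

Reflecting from the negative to the positive side of a hyperplane raises h (`floorSum_lt_affRefl`),
and every reflection changes h by an odd number (`odd_floorSum_affRefl_sub`); both follow by
grouping β with ±s_α β. So if w lies two above y, every chain from y to w has exactly two steps, and
the interval consists of the middle terms of such chains.

If cl(y) = cl(w), both reflections of a chain belong to one root α up to sign, and w arises from y
by a translation along α^∨, which determines α up to sign. The height of the reflection of a point
in F_{α,m} is affine in m with nonzero slope, so the height of z determines z.

If cl(y) ≠ cl(w), the two hyperplanes meet in codimension two, and every factorization of y⁻¹w into
two reflections uses hyperplanes through that intersection (`mem_rankTwo_of_mul_eq_mul`). This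
leaves a dihedral group. Chambers around the intersection have positions p modulo 2k, with 0 at the
top, and reflections towards 0 raise h (`exists_dihedralPosition`). A reflection lowering |p| by
three or more is a product of three successive ascents, so a rise by one lowers |p| by exactly one
(`exists_of_eq_add_one`). The middle terms are then the two elements at positions ±(|p| - 1). -/

namespace SemiInfinite

/-! ### Roots as linear forms, and reflections in the hyperplanes -/

section Roots

variable {ι M V : Type*} [AddCommGroup M] [Module ℝ M] [AddCommGroup V] [Module ℝ V]
  (P : RootPairing ι ℝ M V)

theorem root'_reflectionPerm (i j : ι) (v : V) :
    P.root' (P.reflectionPerm i j) v = P.root' j v - P.pairing j i * P.root' i v := by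
  simp [RootPairing.root', P.root_reflectionPerm, P.reflection_apply_root]

theorem root'_neg (i : ι) (v : V) : P.root' (P.reflectionPerm i i) v = -P.root' i v := by
  rw [root'_reflectionPerm, P.pairing_same]; ring

theorem root'_coreflection (i j : ι) (v : V) :
    P.root' j (P.coreflection i v) = P.root' (P.reflectionPerm i j) v := by
  rw [root'_reflectionPerm, P.coreflection_apply, map_sub, map_smul, P.root'_coroot_eq_pairing,
    smul_eq_mul, mul_comm]

theorem root'_injective {i j : ι} (h : ∀ v, P.root' i v = P.root' j v) : i = j := by
  apply P.root.injective
  apply P.toPerfPair.injective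
  ext v
  simpa [RootPairing.root'] using h v

theorem exists_root'_ne_zero (i : ι) : ∃ v, P.root' i v ≠ 0 :=
  ⟨P.coroot i, by rw [P.root'_coroot_eq_pairing, P.pairing_same]; norm_num⟩

theorem exists_int_pairing [P.IsCrystallographic] (i j : ι) : ∃ n : ℤ, P.pairing i j = n :=
  ⟨P.pairingIn ℤ i j, by rw [← P.algebraMap_pairingIn ℤ]; simp⟩

/-- The reflection in the hyperplane `F_{α,m}`. -/
def affRefl (i : ι) (m : ℤ) (v : V) : V := v - (P.root' i v - m) • P.coroot i

theorem root'_affRefl (i j : ι) (m : ℤ) (v : V) :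
    P.root' j (affRefl P i m v) = P.root' j v - (P.root' i v - m) * P.pairing j i := by
  rw [affRefl, map_sub, map_smul, P.root'_coroot_eq_pairing, smul_eq_mul]

theorem root'_affRefl' (i j : ι) (m : ℤ) (v : V) :
    P.root' j (affRefl P i m v) = P.root' (P.reflectionPerm i j) v + m * P.pairing j i := by
  rw [root'_affRefl, root'_reflectionPerm]; ring

theorem affRefl_affRefl (i : ι) (m : ℤ) (v : V) : affRefl P i m (affRefl P i m v) = v := by
  rw [affRefl, root'_affRefl, P.pairing_same, affRefl]
  module

theorem coroot_neg (i : ι) : P.coroot (P.reflectionPerm i i) = -P.coroot i := by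
  rw [P.coroot_reflectionPerm, P.coreflection_apply_self]

theorem affRefl_neg (i : ι) (m : ℤ) (v : V) :
    affRefl P (P.reflectionPerm i i) (-m) v = affRefl P i m v := by
  simp only [affRefl, root'_neg, coroot_neg]
  push_cast
  module

variable [P.IsReduced]

theorem eq_or_eq_neg_of_root'_eq_mul {i j : ι} {c : ℝ}
    (h : ∀ v, P.root' j v = c * P.root' i v) : j = i ∨ j = P.reflectionPerm i i := by
  have h1 : P.root j = c • P.root i := by
    apply P.toPerfPair.injective
    ext v
    simpa [RootPairing.root'] using h v
  have h2 : ¬ LinearIndependent ℝ ![P.root j, P.root i] := by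
    intro hl
    rw [LinearIndependent.pair_iff] at hl
    have := (hl 1 (-c) (by rw [h1]; module)).1
    norm_num at this
  rcases RootPairing.IsReduced.eq_or_eq_neg j i h2 with h3 | h3
  · exact Or.inl (P.root.injective h3)
  · refine Or.inr (P.root.injective ?_)
    rw [h3, P.root_reflectionPerm, P.reflection_apply_self]

end Roots

/-! ### Sums of integral parts under reflections -/

section Floors

variable {ι M V : Type*} [AddCommGroup M] [Module ℝ M] [AddCommGroup V] [Module ℝ V]

/-- Points off all the hyperplanes `F_{α,m}`. -/
def IsRegular (P : RootPairing ι ℝ M V) (v : V) : Prop := ∀ i, ∀ m : ℤ, P.root' i v ≠ m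

theorem floor_neg_of_forall_ne {x : ℝ} (h : ∀ m : ℤ, x ≠ m) : ⌊-x⌋ = -⌊x⌋ - 1 := by
  rw [Int.floor_eq_iff]
  have h1 := Int.floor_le x
  have h2 := Int.lt_floor_add_one x
  have h3 : (⌊x⌋ : ℝ) < x := lt_of_le_of_ne h1 (h _).symm
  push_cast
  constructor <;> linarith

variable {P : RootPairing ι ℝ M V}

theorem IsRegular.floor_lt {v : V} (h : IsRegular P v) (i : ι) :
    (⌊P.root' i v⌋ : ℝ) < P.root' i v :=
  lt_of_le_of_ne (Int.floor_le _) (h i _).symm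

theorem IsRegular.floor_neg {v : V} (h : IsRegular P v) (i : ι) :
    ⌊P.root' (P.reflectionPerm i i) v⌋ = -⌊P.root' i v⌋ - 1 := by
  rw [root'_neg, floor_neg_of_forall_ne (h i)]

theorem isPos_neg_iff (b : P.Base) (i : ι) :
    b.IsPos (P.reflectionPerm i i) ↔ ¬ b.IsPos i :=
  RootPairing.Base.IsPos.neg_iff_not b i

theorem isPos_iff_root'_neg {b : P.Base} {v : V} (hv : v ∈ baseAlcove b) (i : ι) :
    b.IsPos i ↔ P.root' i v < 0 := by
  refine ⟨fun h => (hv i h).2, fun h => ?_⟩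
  by_contra hi
  have := (hv _ ((isPos_neg_iff b i).2 hi)).2
  rw [root'_neg] at this
  linarith

theorem floor_affRefl [P.IsCrystallographic] (i j : ι) (m : ℤ) (v : V) :
    ⌊P.root' j (affRefl P i m v)⌋ =
      ⌊P.root' (P.reflectionPerm i j) v⌋ + m * P.pairingIn ℤ j i := by
  rw [root'_affRefl', ← P.algebraMap_pairingIn ℤ, algebraMap_int_eq, eq_intCast, ← Int.cast_mul,
    Int.floor_add_intCast]

theorem IsRegular.affRefl [P.IsCrystallographic] {v : V} (h : IsRegular P v) (i : ι) (m : ℤ) :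
    IsRegular P (affRefl P i m v) := by
  intro j n hn
  obtain ⟨c, hc⟩ := exists_int_pairing P j i
  rw [root'_affRefl', hc] at hn
  refine h (P.reflectionPerm i j) (n - m * c) ?_
  push_cast
  linarith

open Classical in
/-- The positive one of the roots `± s_α β`, for `α`, `β` with indices `i`, `j`. -/
noncomputable def posReflect (b : P.Base) (i j : ι) : ι :=
  if b.IsPos (P.reflectionPerm i j) then P.reflectionPerm i j
  else P.reflectionPerm (P.reflectionPerm i j) (P.reflectionPerm i j)

theorem isPos_posReflect (b : P.Base) (i j : ι) : b.IsPos (posReflect b i j) := by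
  unfold posReflect
  split_ifs with h
  · exact h
  · exact (isPos_neg_iff b _).2 h

theorem reflectionPerm_neg (P : RootPairing ι ℝ M V) (i j : ι) :
    P.reflectionPerm i (P.reflectionPerm j j) =
      P.reflectionPerm (P.reflectionPerm i j) (P.reflectionPerm i j) := by
  apply root'_injective P
  intro v
  rw [root'_neg, ← root'_coreflection P i, ← root'_coreflection P i, root'_neg]

theorem neg_neg_index (P : RootPairing ι ℝ M V) (i : ι) :
    P.reflectionPerm (P.reflectionPerm i i) (P.reflectionPerm i i) = i := by
  apply root'_injective P
  intro v
  rw [root'_neg, root'_neg, neg_neg]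

theorem posReflect_posReflect (b : P.Base) {i j : ι} (hj : b.IsPos j) :
    posReflect b i (posReflect b i j) = j := by
  by_cases h : b.IsPos (P.reflectionPerm i j)
  · have h1 : posReflect b i j = P.reflectionPerm i j := by simp [posReflect, h]
    rw [h1]
    simp [posReflect, hj]
  · have h1 : posReflect b i j = P.reflectionPerm (P.reflectionPerm i j) (P.reflectionPerm i j) := by
      simp [posReflect, h]
    have h2 : P.reflectionPerm i (posReflect b i j) = P.reflectionPerm j j := by
      rw [h1, reflectionPerm_neg, P.reflectionPerm_self]
    have h3 : ¬ b.IsPos (P.reflectionPerm j j) := by simpa [isPos_neg_iff] using hj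
    rw [posReflect, h2, if_neg h3, neg_neg_index]

theorem posReflect_self (b : P.Base) {i : ι} (hi : b.IsPos i) : posReflect b i i = i := by
  have h3 : ¬ b.IsPos (P.reflectionPerm i i) := by simpa [isPos_neg_iff] using hi
  rw [posReflect, if_neg h3, neg_neg_index]

/-- The reflection exchanges the forms β and s_α β up to the opposite shifts ±m⟨β, α^∨⟩, so one
integral part gains what the other loses. -/
theorem floor_posReflect_of_isPos [P.IsCrystallographic] (b : P.Base) {i j : ι} (m : ℤ) (v : V)
    (h : b.IsPos (P.reflectionPerm i j)) :
    ⌊P.root' (posReflect b i j) (affRefl P i m v)⌋ - ⌊P.root' (posReflect b i j) v⌋ =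
      -(⌊P.root' j (affRefl P i m v)⌋ - ⌊P.root' j v⌋) := by
  have h1 : posReflect b i j = P.reflectionPerm i j := by simp [posReflect, h]
  have h2 : P.pairingIn ℤ (P.reflectionPerm i j) i = - P.pairingIn ℤ j i := by
    rw [← P.pairingIn_reflectionPerm, P.pairingIn_reflectionPerm_self_right]
  rw [h1, floor_affRefl, floor_affRefl, P.reflectionPerm_self, h2]
  ring

/-- The extra sign makes the two gains equal: off the hyperplanes ⌊-x⌋ = -⌊x⌋ - 1, and the constant
drops out of the difference. -/
theorem floor_posReflect_of_not_isPos [P.IsCrystallographic] (b : P.Base) {i j : ι} (m : ℤ)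
    {v : V} (hv : IsRegular P v)
    (h : ¬ b.IsPos (P.reflectionPerm i j)) :
    ⌊P.root' (posReflect b i j) (affRefl P i m v)⌋ - ⌊P.root' (posReflect b i j) v⌋ =
      ⌊P.root' j (affRefl P i m v)⌋ - ⌊P.root' j v⌋ := by
  have h1 : posReflect b i j = P.reflectionPerm (P.reflectionPerm i j) (P.reflectionPerm i j) := by
    simp [posReflect, h]
  have h2 : P.pairingIn ℤ (P.reflectionPerm i j) i = - P.pairingIn ℤ j i := by
    rw [← P.pairingIn_reflectionPerm, P.pairingIn_reflectionPerm_self_right]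
  rw [h1, (hv.affRefl i m).floor_neg, hv.floor_neg, floor_affRefl, floor_affRefl,
    P.reflectionPerm_self, h2]
  ring

theorem floor_affRefl_self [P.IsCrystallographic] (i : ι) (m : ℤ) {v : V} (hv : IsRegular P v) :
    ⌊P.root' i (affRefl P i m v)⌋ - ⌊P.root' i v⌋ = 2 * (m - ⌊P.root' i v⌋) - 1 := by
  rw [floor_affRefl, hv.floor_neg, P.pairingIn_same]
  ring

variable [Finite ι]

/-- The finite set of (indices of) positive roots. -/
noncomputable def posRoots (b : P.Base) : Finset ι := (Set.toFinite {i | b.IsPos i}).toFinset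

@[simp]
theorem mem_posRoots {b : P.Base} {i : ι} : i ∈ posRoots b ↔ b.IsPos i := by
  simp [posRoots]

/-- The sum over the positive roots `α` of the integral parts of `⟨α, v⟩`. -/
noncomputable def floorSum (b : P.Base) (v : V) : ℤ := ∑ i ∈ posRoots b, ⌊P.root' i v⌋

theorem floorSum_affRefl_sub (b : P.Base) (i : ι) (m : ℤ) (v : V) :
    floorSum b (affRefl P i m v) - floorSum b v =
      ∑ j ∈ posRoots b, (⌊P.root' j (affRefl P i m v)⌋ - ⌊P.root' j v⌋) := by
  rw [floorSum, floorSum, Finset.sum_sub_distrib]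

theorem sum_posReflect (b : P.Base) (i : ι) (f : ι → ℤ) :
    ∑ j ∈ posRoots b, f (posReflect b i j) = ∑ j ∈ posRoots b, f j := by
  refine Finset.sum_nbij' (posReflect b i) (posReflect b i) ?_ ?_ ?_ ?_ ?_
  · intro j _; simpa using isPos_posReflect b i j
  · intro j _; simpa using isPos_posReflect b i j
  · intro j hj; exact posReflect_posReflect b (by simpa using hj)
  · intro j hj; exact posReflect_posReflect b (by simpa using hj)
  · intro j _; rfl

variable [P.IsCrystallographic]

/-- Reflecting a regular point in `F_{α,m}` from the negative to the positive side increases the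
sum of integral parts. -/
theorem floorSum_lt_affRefl {b : P.Base} {v₀ : V} (hv₀ : v₀ ∈ baseAlcove b) {i : ι}
    (hi : b.IsPos i) {m : ℤ} {v : V} (hv : IsRegular P v) (h : P.root' i v < m) :
    floorSum b v < floorSum b (affRefl P i m v) := by
  have hpos := isPos_iff_root'_neg hv₀
  set f : ι → ℤ := fun j => ⌊P.root' j (affRefl P i m v)⌋ - ⌊P.root' j v⌋ with hf
  -- Since `posReflect` permutes the positive roots, this sum is twice the change of height.
  have h1 : 0 < ∑ j ∈ posRoots b, (f j + f (posReflect b i j)) := by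
    have hlt : ⌊P.root' i v⌋ < m := Int.floor_lt.2 h
    have hself : 0 < f i + f (posReflect b i i) := by
      rw [posReflect_self b hi]
      have := floor_affRefl_self i m hv
      simp only [hf]
      omega
    refine Finset.sum_pos' ?_ ⟨i, by simpa using hi, hself⟩
    intro j hj
    have hj : b.IsPos j := by simpa using hj
    by_cases hp : b.IsPos (P.reflectionPerm i j)
    · have := floor_posReflect_of_isPos b m v hp
      simp only [hf]
      omega
    · have h2 := floor_posReflect_of_not_isPos b m hv hp
      have h3 : ⌊P.root' j v⌋ ≤ ⌊P.root' j (affRefl P i m v)⌋ := by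
        apply Int.floor_mono
        rw [root'_affRefl]
        -- Otherwise s_α β = β - ⟨β, α^∨⟩α would be negative at v₀, hence a positive root.
        have h4 : 0 < P.pairing j i := by
          by_contra hc
          apply hp
          rw [hpos, root'_reflectionPerm]
          nlinarith [(hpos j).1 hj, (hpos i).1 hi]
        nlinarith
      simp only [hf]
      omega
  rw [Finset.sum_add_distrib, sum_posReflect b i f] at h1
  have h2 := floorSum_affRefl_sub b i m v
  change _ = ∑ j ∈ posRoots b, f j at h2
  omega

/-- A reflection changes the parity of the sum of integral parts. -/
theorem odd_floorSum_affRefl_sub [P.IsReduced] (b : P.Base) {i : ι} (hi : b.IsPos i)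
    (m : ℤ) {v : V} (hv : IsRegular P v) :
    Odd (floorSum b (affRefl P i m v) - floorSum b v) := by
  classical
  rw [floorSum_affRefl_sub]
  set f : ι → ℤ := fun j => ⌊P.root' j (affRefl P i m v)⌋ - ⌊P.root' j v⌋ with hf
  have hi' : i ∈ posRoots b := by simpa using hi
  rw [← Finset.add_sum_erase _ _ hi']
  have h1 : Odd (⌊P.root' i (affRefl P i m v)⌋ - ⌊P.root' i v⌋) :=
    ⟨m - ⌊P.root' i v⌋ - 1, by rw [floor_affRefl_self i m hv]; ring⟩
  refine h1.add_even ?_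
  rw [even_iff_two_dvd, ← Nat.cast_ofNat, ← ZMod.intCast_zmod_eq_zero_iff_dvd]
  rw [Int.cast_sum]
  -- Either s_α β = β, and the change is its own negative, or s_α β = -β, which forces β = ±α.
  have hfix : ∀ j, b.IsPos j → posReflect b i j = j → j ≠ i → f j = 0 := by
    intro j hj hfx hji
    by_cases hp : b.IsPos (P.reflectionPerm i j)
    · have h1 := floor_posReflect_of_isPos b m v hp
      rw [hfx] at h1
      simp only [hf]
      omega
    · exfalso
      have h2 : P.reflectionPerm (P.reflectionPerm i j) (P.reflectionPerm i j) = j := by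
        simpa [posReflect, hp] using hfx
      have h3 : ∀ v, P.root' j v = (P.pairing j i / 2) * P.root' i v := by
        intro v
        have h4 : P.root' j v = - (P.root' j v - P.pairing j i * P.root' i v) := by
          rw [← root'_reflectionPerm, ← root'_neg, h2]
        linarith
      rcases eq_or_eq_neg_of_root'_eq_mul P h3 with h4 | h4
      · exact hji h4
      · rw [h4, isPos_neg_iff] at hj
        exact hj hi
  refine Finset.sum_involution (fun j _ => posReflect b i j) ?_ ?_ ?_ ?_
  · intro j hj
    by_cases hp : b.IsPos (P.reflectionPerm i j)
    · rw [floor_posReflect_of_isPos b m v hp]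
      push_cast; ring
    · rw [floor_posReflect_of_not_isPos b m hv hp]
      exact CharTwo.add_self_eq_zero _
  · intro j hj hne heq
    simp only [Finset.mem_erase, mem_posRoots] at hj
    apply hne
    have := hfix j hj.2 heq hj.1
    simp only [hf] at this
    rw [this]; simp
  · intro j hj
    simp only [Finset.mem_erase, mem_posRoots] at hj ⊢
    refine ⟨fun heq => hj.1 ?_, isPos_posReflect b i j⟩
    have := posReflect_posReflect b (i := i) hj.2
    rw [heq, posReflect_self b hi] at this
    exact this.symm
  · intro j hj
    simp only [Finset.mem_erase, mem_posRoots] at hj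
    exact posReflect_posReflect b hj.2

end Floors

/-! ### Alcoves as sets of constant integral parts -/

section Alcoves

open Topology Filter

variable {ι M V : Type*} [AddCommGroup M] [Module ℝ M] [AddCommGroup V] [Module ℝ V]
  {P : RootPairing ι ℝ M V}

/-- The regular points with the same integral parts `⌊⟨α, v⟩⌋` as `v`. -/
def cell (P : RootPairing ι ℝ M V) (v : V) : Set V :=
  {u | IsRegular P u ∧ ∀ i, ⌊P.root' i u⌋ = ⌊P.root' i v⌋}

theorem mem_cell_self {v : V} (hv : IsRegular P v) : v ∈ cell P v := ⟨hv, fun _ => rfl⟩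

theorem isRegular_of_forall_between {v : V}
    (h : ∀ i, ∃ k : ℤ, (k : ℝ) < P.root' i v ∧ P.root' i v < k + 1) : IsRegular P v := by
  intro i m hm
  obtain ⟨k, h1, h2⟩ := h i
  rw [hm] at h1 h2
  norm_cast at h1 h2
  omega

theorem floor_eq_of_between {x : ℝ} {k : ℤ} (h : (k : ℝ) < x ∧ x < k + 1) : ⌊x⌋ = k :=
  Int.floor_eq_iff.2 ⟨h.1.le, h.2⟩

theorem mem_cell_iff {u v : V} :
    u ∈ cell P v ↔
      ∀ i, (⌊P.root' i v⌋ : ℝ) < P.root' i u ∧ P.root' i u < ⌊P.root' i v⌋ + 1 := by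
  constructor
  · rintro ⟨h1, h2⟩ i
    rw [← h2 i]
    exact ⟨h1.floor_lt i, Int.lt_floor_add_one _⟩
  · intro h
    exact ⟨isRegular_of_forall_between fun i => ⟨_, h i⟩, fun i => floor_eq_of_between (h i)⟩

theorem mem_cell_iff_isPos (b : P.Base) {u v : V} (hv : IsRegular P v) :
    u ∈ cell P v ↔ ∀ i, b.IsPos i →
      (⌊P.root' i v⌋ : ℝ) < P.root' i u ∧ P.root' i u < ⌊P.root' i v⌋ + 1 := by
  rw [mem_cell_iff]
  refine ⟨fun h i _ => h i, fun h i => ?_⟩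
  by_cases hi : b.IsPos i
  · exact h i hi
  · have := h _ ((isPos_neg_iff b i).2 hi)
    rw [hv.floor_neg, root'_neg] at this
    push_cast at this
    constructor <;> linarith [this.1, this.2]

theorem cell_eq_of_mem {u v : V} (h : u ∈ cell P v) : cell P u = cell P v := by
  ext w
  simp only [cell, Set.mem_ofPred_eq, h.2]

theorem convex_cell (v : V) : Convex ℝ (cell P v) := by
  intro x hx y hy s t hs ht hst
  rw [mem_cell_iff] at *
  intro i
  simp only [map_add, map_smul, smul_eq_mul]
  have h : s = 1 - t := by linarith
  subst h
  obtain ⟨h1, h2⟩ := hx i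
  obtain ⟨h3, h4⟩ := hy i
  rcases ht.eq_or_lt with h | h
  · subst h; simpa using ⟨h1, h2⟩
  · constructor <;> nlinarith

theorem setOf_notMem_hyperplane_eq (b : P.Base) :
    {u : V | ∀ i, b.IsPos i → ∀ m : ℤ, u ∉ hyperplane P i m} = {u | IsRegular P u} := by
  ext u
  refine ⟨fun h i m hm => ?_, fun h i _ m => h i m⟩
  by_cases hi : b.IsPos i
  · exact h i hi m hm
  · refine h _ ((isPos_neg_iff b i).2 hi) (-m) ?_
    simp [hyperplane, root'_neg, hm]

variable [TopologicalSpace V] [IsTopologicalAddGroup V] [ContinuousSMul ℝ V] [T2Space V]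
  [Finite ι] [P.IsRootSystem]

theorem continuous_root' (i : ι) : Continuous (P.root' i) := by
  have : FiniteDimensional ℝ V := by
    have h := RootPairing.IsRootSystem.span_coroot_eq_top (P := P)
    exact ⟨by rw [← h]; exact Submodule.fg_span (Set.finite_range _)⟩
  exact LinearMap.continuous_of_finiteDimensional _

/-- By the intermediate value theorem an integral part cannot change on a connected set of regular
points; conversely a cell is convex. -/
theorem connectedComponentIn_eq_cell {v : V} (hv : IsRegular P v) :
    connectedComponentIn {u | IsRegular P u} v = cell P v := by
  apply Set.Subset.antisymm
  · intro u hu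
    refine ⟨connectedComponentIn_subset _ _ hu, fun i => ?_⟩
    have hpre : (P.root' i '' connectedComponentIn {u | IsRegular P u} v).OrdConnected :=
      (isPreconnected_connectedComponentIn.image _ (continuous_root' i).continuousOn).ordConnected
    have h1 : P.root' i u ∈ P.root' i '' connectedComponentIn {u | IsRegular P u} v := ⟨u, hu, rfl⟩
    have h2 : P.root' i v ∈ P.root' i '' connectedComponentIn {u | IsRegular P u} v :=
      ⟨v, mem_connectedComponentIn hv, rfl⟩
    have key : ∀ x y, x ∈ P.root' i '' connectedComponentIn {u | IsRegular P u} v →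
        y ∈ P.root' i '' connectedComponentIn {u | IsRegular P u} v → ⌊x⌋ ≤ ⌊y⌋ := by
      intro x y hx hy
      by_contra! hlt
      have hm : ((⌊y⌋ + 1 : ℤ) : ℝ) ∈ Set.Icc y x :=
        ⟨by push_cast; exact (Int.lt_floor_add_one y).le, Int.le_floor.1 hlt⟩
      obtain ⟨w, hw, hw'⟩ := hpre.out hy hx hm
      exact connectedComponentIn_subset _ _ hw i _ hw'
    exact le_antisymm (key _ _ h1 h2) (key _ _ h2 h1)
  · exact (convex_cell v).isPreconnected.subset_connectedComponentIn (mem_cell_self hv)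
      fun u hu => hu.1

theorem isAlcove_cell (b : P.Base) {v : V} (hv : IsRegular P v) : IsAlcove b (cell P v) := by
  refine ⟨v, ?_, ?_⟩
  · rw [setOf_notMem_hyperplane_eq]; exact hv
  · rw [setOf_notMem_hyperplane_eq, connectedComponentIn_eq_cell hv]

theorem IsAlcove.exists_eq_cell {b : P.Base} {A : Set V} (h : IsAlcove b A) :
    ∃ v, IsRegular P v ∧ A = cell P v := by
  obtain ⟨v, hv, rfl⟩ := h
  rw [setOf_notMem_hyperplane_eq] at hv ⊢
  exact ⟨v, hv, connectedComponentIn_eq_cell hv⟩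

/-- For the converse, an arbitrarily small move towards v makes the weak inequalities strict. -/
theorem mem_closure_cell_iff (b : P.Base) {u v : V} (hv : IsRegular P v) :
    u ∈ closure (cell P v) ↔ ∀ i, b.IsPos i →
      (⌊P.root' i v⌋ : ℝ) ≤ P.root' i u ∧ P.root' i u ≤ ⌊P.root' i v⌋ + 1 := by
  constructor
  · intro hu i hi
    have hc : IsClosed {u : V | (⌊P.root' i v⌋ : ℝ) ≤ P.root' i u ∧
        P.root' i u ≤ ⌊P.root' i v⌋ + 1} :=
      (isClosed_le continuous_const (continuous_root' i)).inter
        (isClosed_le (continuous_root' i) continuous_const)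
    refine closure_minimal ?_ hc hu
    intro w hw
    obtain ⟨h1, h2⟩ := mem_cell_iff.1 hw i
    exact ⟨h1.le, h2.le⟩
  · intro h
    have ht : Tendsto (fun t : ℝ => u + t • (v - u)) (𝓝[>] 0) (𝓝 u) := by
      have hcont : Continuous (fun t : ℝ => u + t • (v - u)) := by fun_prop
      have := (hcont.tendsto 0).mono_left (nhdsWithin_le_nhds (s := Set.Ioi 0))
      simpa using this
    refine mem_closure_of_tendsto ht ?_
    filter_upwards [Ioo_mem_nhdsGT (zero_lt_one' ℝ)] with t ht
    rw [mem_cell_iff_isPos b hv]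
    intro i hi
    obtain ⟨h1, h2⟩ := h i hi
    have h3 := hv.floor_lt i
    have h4 := Int.lt_floor_add_one (P.root' i v)
    simp only [map_add, map_smul, map_sub, smul_eq_mul]
    obtain ⟨ht0, ht1⟩ := ht
    constructor <;> nlinarith

end Alcoves

/-! ### Walls and adjacent alcoves -/

section Walls

variable {ι M V : Type*} [AddCommGroup M] [Module ℝ M] [AddCommGroup V] [Module ℝ V]
  (P : RootPairing ι ℝ M V)

/-- The hyperplane `F_{α,m}` as an affine subspace. -/
def affineHyperplane (i : ι) (m : ℤ) : AffineSubspace ℝ V where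
  carrier := hyperplane P i m
  smul_vsub_vadd_mem' := by
    intro c p q r hp hq hr
    simp only [hyperplane, Set.mem_ofPred_eq] at *
    simp [hp, hq, hr]

theorem affineSpan_subset_hyperplane {S : Set V} {i : ι} {m : ℤ} (h : S ⊆ hyperplane P i m) :
    (affineSpan ℝ S : Set V) ⊆ hyperplane P i m :=
  affineSpan_le (Q := affineHyperplane P i m) |>.2 h

theorem hyperplane_nonempty (i : ι) (m : ℤ) : (hyperplane P i m).Nonempty := by
  refine ⟨((m : ℝ) / 2) • P.coroot i, ?_⟩
  simp only [hyperplane, Set.mem_ofPred_eq, map_smul, P.root'_coroot_eq_pairing, P.pairing_same,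
    smul_eq_mul]
  ring

/-- Moving within the smaller hyperplane along the kernel of its form leaves the other form
unchanged, so the forms are proportional. -/
theorem exists_root'_eq_mul_of_hyperplane_subset {i j : ι} {m n : ℤ}
    (h : hyperplane P j n ⊆ hyperplane P i m) : ∃ c : ℝ, c ≠ 0 ∧
      ∀ v, P.root' i v = c * P.root' j v := by
  obtain ⟨p, hp⟩ := hyperplane_nonempty P j n
  have key : ∀ v, P.root' i v = (P.pairing i j / 2) * P.root' j v := by
    intro v
    have h1 : p + (v - (P.root' j v / 2) • P.coroot j) ∈ hyperplane P j n := by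
      simp only [hyperplane, Set.mem_ofPred_eq] at hp ⊢
      simp only [map_add, map_sub, map_smul, P.root'_coroot_eq_pairing, P.pairing_same,
        smul_eq_mul, hp]
      ring
    have h2 := h h1
    have h3 := h hp
    simp only [hyperplane, Set.mem_ofPred_eq, map_add, map_sub, map_smul,
      P.root'_coroot_eq_pairing, smul_eq_mul] at h2 h3
    linarith
  refine ⟨_, fun hc => ?_, key⟩
  obtain ⟨v, hv⟩ := exists_root'_ne_zero P i
  apply hv
  rw [key, hc, zero_mul]

variable {P}

theorem eq_of_hyperplane_subset [P.IsReduced] {b : P.Base} {i j k : ι} {l m n : ℤ}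
    (hi : b.IsPos i) (hk : b.IsPos k)
    (h : hyperplane P j n ⊆ hyperplane P i m) (h' : hyperplane P j n ⊆ hyperplane P k l) :
    k = i := by
  obtain ⟨c, hc, hc'⟩ := exists_root'_eq_mul_of_hyperplane_subset P h
  obtain ⟨d, hd, hd'⟩ := exists_root'_eq_mul_of_hyperplane_subset P h'
  have h1 : ∀ v, P.root' k v = (d / c) * P.root' i v := by
    intro v; rw [hc', hd']; field_simp
  rcases eq_or_eq_neg_of_root'_eq_mul P h1 with h2 | h2
  · exact h2
  · rw [h2, isPos_neg_iff] at hk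
    exact absurd hi hk

variable [TopologicalSpace V] [IsTopologicalAddGroup V] [ContinuousSMul ℝ V] [T2Space V]
  [Finite ι] [P.IsRootSystem] [P.IsReduced]

/-- A wall spans its hyperplane, so it lies in hyperplanes of a single positive root. If the
integral part at a second root changed, the wall would also lie in a hyperplane of that root. -/
theorem StepUp.floor {b : P.Base} {v w : V} (hv : IsRegular P v) (hw : IsRegular P w)
    (h : StepUp b (cell P v) (cell P w)) :
    ∃ i, b.IsPos i ∧ ⌊P.root' i w⌋ = ⌊P.root' i v⌋ + 1 ∧
      ∀ k, b.IsPos k → k ≠ i → ⌊P.root' k w⌋ = ⌊P.root' k v⌋ := by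
  obtain ⟨-, -, S, ⟨⟨j, hj, n, hS, hspan⟩, ⟨j', hj', n', hS', -⟩⟩, -, i, hi, m, hSi, hvi, hwi⟩ := h
  have hSv : S ⊆ closure (cell P v) := hS ▸ Set.inter_subset_right
  have hSw : S ⊆ closure (cell P w) := hS' ▸ Set.inter_subset_right
  have hji : hyperplane P j n ⊆ hyperplane P i m := hspan ▸ affineSpan_subset_hyperplane P hSi
  have hSne : S.Nonempty := by
    rw [← affineSpan_nonempty ℝ, hspan]
    exact hyperplane_nonempty P j n
  refine ⟨i, hi, ?_, ?_⟩
  · obtain ⟨p, hp⟩ := hSne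
    have h1 := ((mem_closure_cell_iff b hv).1 (hSv hp) i hi).2
    have h2 := ((mem_closure_cell_iff b hw).1 (hSw hp) i hi).1
    have h3 : P.root' i p = m := hSi hp
    have h4 : -(P.root' i v - m) > 0 := hvi (mem_cell_self hv)
    have h5 : P.root' i w - m > 0 := hwi (mem_cell_self hw)
    have h6 : ⌊P.root' i v⌋ < m := Int.floor_lt.2 (by linarith)
    have h7 : m ≤ ⌊P.root' i w⌋ := Int.le_floor.2 (by linarith)
    rw [h3] at h1 h2
    norm_cast at h1 h2
    omega
  · intro k hk hki
    by_contra hne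
    apply hki
    have : ∃ l : ℤ, S ⊆ hyperplane P k l := by
      rcases lt_or_gt_of_ne hne with hlt | hlt
      · refine ⟨⌊P.root' k v⌋, fun p hp => le_antisymm ?_ ?_⟩
        · refine (((mem_closure_cell_iff b hw).1 (hSw hp) k hk).2).trans ?_
          exact_mod_cast hlt
        · exact ((mem_closure_cell_iff b hv).1 (hSv hp) k hk).1
      · refine ⟨⌊P.root' k w⌋, fun p hp => le_antisymm ?_ ?_⟩
        · refine (((mem_closure_cell_iff b hv).1 (hSv hp) k hk).2).trans ?_
          exact_mod_cast hlt
        · exact ((mem_closure_cell_iff b hw).1 (hSw hp) k hk).1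
    obtain ⟨l, hl⟩ := this
    exact eq_of_hyperplane_subset hi hk hji (hspan ▸ affineSpan_subset_hyperplane P hl)

/-- The segment from v to w crosses only F_{α,m}. The crossing point is interior to the common face
relative to F_{α,m}, so this face spans the hyperplane. -/
theorem stepUp_of_floor {b : P.Base} {v w : V} (hv : IsRegular P v) (hw : IsRegular P w) {i : ι}
    (hi : b.IsPos i) (hvw : ⌊P.root' i w⌋ = ⌊P.root' i v⌋ + 1)
    (hne : ∀ k, b.IsPos k → k ≠ i → ⌊P.root' k w⌋ = ⌊P.root' k v⌋) :
    StepUp b (cell P v) (cell P w) := by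
  set m := ⌊P.root' i w⌋ with hm
  have hvm : P.root' i v < m := by
    have := Int.lt_floor_add_one (P.root' i v)
    rw [hvw]; push_cast; exact this
  have hwm : (m : ℝ) < P.root' i w := hw.floor_lt i
  -- both closed faces are described by the same inequalities
  have face : ∀ u, u ∈ hyperplane P i m ∩ closure (cell P v) ↔ P.root' i u = m ∧
      ∀ k, b.IsPos k → k ≠ i →
        (⌊P.root' k v⌋ : ℝ) ≤ P.root' k u ∧ P.root' k u ≤ ⌊P.root' k v⌋ + 1 := by
    intro u
    rw [Set.mem_inter_iff, mem_closure_cell_iff b hv]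
    refine and_congr_right fun hu => ⟨fun h k hk _ => h k hk, fun h k hk => ?_⟩
    by_cases hki : k = i
    · subst hki
      change P.root' k u = m at hu
      rw [hu, hvw]; push_cast
      constructor <;> linarith
    · exact h k hk hki
  have face' : ∀ u, u ∈ hyperplane P i m ∩ closure (cell P w) ↔ P.root' i u = m ∧
      ∀ k, b.IsPos k → k ≠ i →
        (⌊P.root' k v⌋ : ℝ) ≤ P.root' k u ∧ P.root' k u ≤ ⌊P.root' k v⌋ + 1 := by
    intro u
    rw [Set.mem_inter_iff, mem_closure_cell_iff b hw]
    refine and_congr_right fun hu => ⟨fun h k hk hki => ?_, fun h k hk => ?_⟩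
    · rw [← hne k hk hki]; exact h k hk
    · by_cases hki : k = i
      · subst hki
        change P.root' k u = m at hu
        rw [hu]
        constructor <;> linarith
      · rw [hne k hk hki]; exact h k hk hki
  have hfaces : hyperplane P i m ∩ closure (cell P v) = hyperplane P i m ∩ closure (cell P w) := by
    ext u; rw [face, face']
  -- a relative interior point of the common face
  obtain ⟨p, hp, hpk⟩ : ∃ p, P.root' i p = m ∧ ∀ k, b.IsPos k → k ≠ i →
      (⌊P.root' k v⌋ : ℝ) < P.root' k p ∧ P.root' k p < ⌊P.root' k v⌋ + 1 := by
    set d := P.root' i w - P.root' i v with hd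
    have hd0 : 0 < d := by linarith
    set t := (m - P.root' i v) / d with ht
    have ht0 : 0 < t := div_pos (by linarith) hd0
    have ht1 : t < 1 := (div_lt_one hd0).2 (by linarith)
    have htd : t * d = m - P.root' i v := div_mul_cancel₀ _ hd0.ne'
    refine ⟨v + t • (w - v), ?_, fun k hk hki => ?_⟩
    · simp only [map_add, map_smul, map_sub, smul_eq_mul]
      linarith
    · simp only [map_add, map_smul, map_sub, smul_eq_mul]
      have h1 := hv.floor_lt k
      have h2 := Int.lt_floor_add_one (P.root' k v)
      have h3 := hw.floor_lt k
      have h4 := Int.lt_floor_add_one (P.root' k w)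
      rw [hne k hk hki] at h3 h4
      constructor <;> nlinarith
  have hspan : (affineSpan ℝ (hyperplane P i m ∩ closure (cell P v)) : Set V) =
      hyperplane P i m := by
    apply Set.Subset.antisymm
    · exact affineSpan_subset_hyperplane P Set.inter_subset_left
    · intro u hu
      change P.root' i u = m at hu
      have hev : ∀ᶠ ε in nhdsWithin (0 : ℝ) (Set.Ioi 0),
          ∀ k, b.IsPos k → k ≠ i → (⌊P.root' k v⌋ : ℝ) ≤ P.root' k (p + ε • (u - p)) ∧
            P.root' k (p + ε • (u - p)) ≤ ⌊P.root' k v⌋ + 1 := by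
        rw [Filter.eventually_all]
        intro k
        by_cases hk : b.IsPos k ∧ k ≠ i
        · have ht : Filter.Tendsto (fun ε : ℝ => P.root' k (p + ε • (u - p)))
              (nhdsWithin (0 : ℝ) (Set.Ioi 0)) (nhds (P.root' k p)) := by
            have hc : Continuous (fun ε : ℝ => P.root' k (p + ε • (u - p))) := by
              simp only [map_add, map_smul]
              fun_prop
            have := (hc.tendsto 0).mono_left (nhdsWithin_le_nhds (s := Set.Ioi 0))
            simpa using this
          filter_upwards [ht (Ioo_mem_nhds (hpk k hk.1 hk.2).1 (hpk k hk.1 hk.2).2)] with ε h _ _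
          exact ⟨h.1.le, h.2.le⟩
        · refine Filter.Eventually.of_forall fun ε h1 h2 => absurd ⟨h1, h2⟩ hk
      obtain ⟨ε, hε, hε0⟩ := (hev.and self_mem_nhdsWithin).exists
      have hε0 : (0 : ℝ) < ε := hε0
      have hpS : p ∈ affineSpan ℝ (hyperplane P i m ∩ closure (cell P v)) := by
        refine subset_affineSpan _ _ ((face p).2 ⟨hp, fun k hk hki => ?_⟩)
        exact ⟨(hpk k hk hki).1.le, (hpk k hk hki).2.le⟩
      have hqS : p + ε • (u - p) ∈ affineSpan ℝ (hyperplane P i m ∩ closure (cell P v)) := by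
        refine subset_affineSpan _ _ ((face _).2 ⟨?_, hε⟩)
        simp [hp, hu]
      have := AffineSubspace.smul_vsub_vadd_mem _ ε⁻¹ hqS hpS hpS
      have he : ε⁻¹ • (p + ε • (u - p) -ᵥ p) +ᵥ p = u := by
        simp only [vsub_eq_sub, add_sub_cancel_left, vadd_eq_add, smul_smul,
          inv_mul_cancel₀ hε0.ne', one_smul, sub_add_cancel]
      rwa [he] at this
  refine ⟨isAlcove_cell b hv, isAlcove_cell b hw, hyperplane P i m ∩ closure (cell P v),
    ⟨⟨i, hi, m, rfl, hspan⟩, ⟨i, hi, m, hfaces, hspan⟩⟩, ?_, i, hi, m, Set.inter_subset_left, ?_, ?_⟩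
  · rintro T ⟨⟨j, hj, n, hT, hTspan⟩, ⟨j', hj', n', hT', -⟩⟩
    have hTv : T ⊆ closure (cell P v) := hT ▸ Set.inter_subset_right
    have hTw : T ⊆ closure (cell P w) := hT' ▸ Set.inter_subset_right
    have hTi : T ⊆ hyperplane P i m := by
      intro q hq
      have h1 := ((mem_closure_cell_iff b hv).1 (hTv hq) i hi).2
      have h2 := ((mem_closure_cell_iff b hw).1 (hTw hq) i hi).1
      refine le_antisymm ?_ h2
      refine h1.trans (le_of_eq ?_)
      rw [hvw]; push_cast; ring
    have hsub : hyperplane P j n ⊆ hyperplane P i m :=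
      hTspan ▸ affineSpan_subset_hyperplane P hTi
    have hij : i = j := eq_of_hyperplane_subset hj hi subset_rfl hsub
    subst hij
    have hmn : n = m := by
      obtain ⟨q, hq⟩ := hyperplane_nonempty P i n
      have h2 : P.root' i q = m := hsub hq
      have h1 : P.root' i q = n := hq
      exact_mod_cast h1.symm.trans h2
    rw [hT, hmn]
  · intro u hu
    have := (mem_cell_iff.1 hu i).2
    change -(P.root' i u - m) > 0
    rw [hvw]; push_cast; linarith
  · intro u hu
    have := (mem_cell_iff.1 hu i).1
    change P.root' i u - m > 0
    linarith

end Walls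

/-! ### Galleries and the signed distance -/

section Galleries

open Topology Filter

variable {ι M V : Type*} [AddCommGroup M] [Module ℝ M] [AddCommGroup V] [Module ℝ V]
  {P : RootPairing ι ℝ M V}

theorem tendsto_add_mul_nhdsGT (t₀ r s : ℝ) :
    Tendsto (fun t : ℝ => r + t * s) (𝓝[>] t₀) (𝓝 (r + t₀ * s)) := by
  have hcont : Continuous (fun t : ℝ => r + t * s) := by fun_prop
  exact (hcont.tendsto t₀).mono_left nhdsWithin_le_nhds

theorem eventually_nhdsGT_ne (c : ℝ) : ∀ᶠ t in 𝓝[>] (0 : ℝ), t ≠ c := by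
  rcases eq_or_ne c 0 with rfl | hc
  · filter_upwards [self_mem_nhdsWithin] with t ht
    exact ne_of_gt ht
  · exact eventually_nhdsWithin_of_eventually_nhds (isOpen_ne.mem_nhds hc.symm)

theorem floorSum_eq_of_mem_cell [Finite ι] (b : P.Base) {u v : V} (h : u ∈ cell P v) :
    floorSum b u = floorSum b v :=
  Finset.sum_congr rfl fun i _ => h.2 i

variable [Finite ι] [P.IsReduced]

/-- A cell contains points from which the segment to `y` crosses no two of the hyperplanes
`⟨α_i, ·⟩ = m i`, `i ∈ J`, at the same time. -/
theorem exists_mem_cell_generic {v y : V} (hv : IsRegular P v) (hy : IsRegular P y) (J : Set ι)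
    (hJ : ∀ i ∈ J, P.reflectionPerm i i ∉ J) (m : ι → ℤ) :
    ∃ x ∈ cell P v, ∀ i ∈ J, ∀ j ∈ J, i ≠ j →
      (m i - P.root' i x) * P.root' j (y - x) ≠ (m j - P.root' j x) * P.root' i (y - x) := by
  -- The two sides of the required inequality differ by L(y - x), the quadratic terms cancelling. L
  -- is nonzero because y is regular and distinct roots in J are not proportional.
  let L : {p : ι × ι // p.1 ∈ J ∧ p.2 ∈ J ∧ p.1 ≠ p.2} → Module.Dual ℝ V := fun p =>
    (m p.1.1 - P.root' p.1.1 y) • P.root' p.1.2 - (m p.1.2 - P.root' p.1.2 y) • P.root' p.1.1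
  obtain ⟨u, hu⟩ := Module.Dual.exists_forall_ne_zero_of_forall_exists L (by
    rintro ⟨⟨i, j⟩, hi, hj, hij⟩
    by_contra! h
    have hmi : (m i : ℝ) - P.root' i y ≠ 0 := sub_ne_zero.2 (hy i _).symm
    have h1 : ∀ w, P.root' j w = ((m j - P.root' j y) / (m i - P.root' i y)) * P.root' i w := by
      intro w
      have := h w
      simp only [L, LinearMap.sub_apply, LinearMap.smul_apply, smul_eq_mul] at this
      field_simp
      linarith
    rcases eq_or_eq_neg_of_root'_eq_mul P h1 with h2 | h2
    · exact hij h2.symm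
    · exact hJ i hi (h2 ▸ hj))
  have h1 : ∀ᶠ ε in 𝓝[>] (0 : ℝ), ∀ i, (⌊P.root' i v⌋ : ℝ) < P.root' i v + ε * P.root' i u ∧
      P.root' i v + ε * P.root' i u < ⌊P.root' i v⌋ + 1 := by
    rw [eventually_all]
    intro i
    have ht := tendsto_add_mul_nhdsGT 0 (P.root' i v) (P.root' i u)
    rw [zero_mul, add_zero] at ht
    exact ht (Ioo_mem_nhds (hv.floor_lt i) (Int.lt_floor_add_one _))
  have h2 : ∀ᶠ ε in 𝓝[>] (0 : ℝ), ∀ p, ε ≠ L p (y - v) / L p u := by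
    rw [eventually_all]
    exact fun p => eventually_nhdsGT_ne _
  obtain ⟨ε, hε1, hε2⟩ := (h1.and h2).exists
  refine ⟨v + ε • u, mem_cell_iff.2 fun i => by simpa using hε1 i, fun i hi j hj hij heq => ?_⟩
  apply hε2 ⟨(i, j), hi, hj, hij⟩
  rw [eq_div_iff (hu _)]
  simp only [L, LinearMap.sub_apply, LinearMap.smul_apply, smul_eq_mul, map_add, map_sub,
    map_smul] at heq ⊢
  linarith

/-- From the cell of `v` one can cross a single hyperplane towards `y`. -/
theorem exists_adjacent {v y : V} (hv : IsRegular P v) (hy : IsRegular P y) {i₀ : ι}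
    (hi₀ : ⌊P.root' i₀ v⌋ < ⌊P.root' i₀ y⌋) :
    ∃ c i, IsRegular P c ∧ ⌊P.root' i v⌋ < ⌊P.root' i y⌋ ∧ ⌊P.root' i c⌋ = ⌊P.root' i v⌋ + 1 ∧
      ∀ j, j ≠ i → j ≠ P.reflectionPerm i i → ⌊P.root' j c⌋ = ⌊P.root' j v⌋ := by
  -- From each pair ±α with hyperplanes separating v from y, J takes the root that increases towards
  -- y.
  set J : Set ι := {i | ⌊P.root' i v⌋ < ⌊P.root' i y⌋} with hJdef
  obtain ⟨x, hx, hgen⟩ := exists_mem_cell_generic hv hy J (by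
    intro i hi hi'
    simp only [J, Set.mem_ofPred_eq] at hi hi'
    rw [hv.floor_neg, hy.floor_neg] at hi'
    omega) (fun i => ⌊P.root' i v⌋ + 1)
  have hx1 := mem_cell_iff.1 hx
  set t : ι → ℝ := fun i => ((⌊P.root' i v⌋ + 1 : ℤ) - P.root' i x) / P.root' i (y - x) with ht
  have hyi : ∀ i ∈ J, (⌊P.root' i v⌋ : ℝ) + 1 < P.root' i y := by
    intro i hi
    have h1 := hy.floor_lt i
    have h2 : ((⌊P.root' i v⌋ + 1 : ℤ) : ℝ) ≤ ⌊P.root' i y⌋ := by exact_mod_cast hi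
    push_cast at h2
    linarith
  have hd : ∀ i ∈ J, 0 < P.root' i (y - x) := by
    intro i hi
    rw [map_sub]
    linarith [hyi i hi, (hx1 i).2]
  have htd : ∀ i ∈ J, P.root' i x + t i * P.root' i (y - x) = ⌊P.root' i v⌋ + 1 := by
    intro i hi
    simp only [ht]
    rw [div_mul_cancel₀ _ (hd i hi).ne']
    push_cast; ring
  -- The first hyperplane met by the segment from x to y; by the choice of x no other is met at that
  -- time.
  obtain ⟨i, hi, hmin⟩ := Set.exists_min_image J t (Set.toFinite J) ⟨i₀, hi₀⟩
  have hti0 : 0 < t i := by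
    refine div_pos ?_ (hd i hi)
    push_cast; linarith [(hx1 i).2]
  have hti1 : t i < 1 := by
    rw [ht, div_lt_one (hd i hi), map_sub]
    push_cast; linarith [hyi i hi]
  have hlt : ∀ j ∈ J, j ≠ i → t i < t j := by
    intro j hj hji
    refine lt_of_le_of_ne (hmin j hj) fun h => ?_
    apply hgen i hi j hj hji.symm
    have h1 : t i * P.root' i (y - x) = (⌊P.root' i v⌋ + 1 : ℤ) - P.root' i x :=
      div_mul_cancel₀ _ (hd i hi).ne'
    have h2 : t j * P.root' j (y - x) = (⌊P.root' j v⌋ + 1 : ℤ) - P.root' j x :=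
      div_mul_cancel₀ _ (hd j hj).ne'
    rw [← h1, ← h2, h]; ring
  -- the values at the first crossing
  have hJval : ∀ j ∈ J, j ≠ i → (⌊P.root' j v⌋ : ℝ) < P.root' j x + t i * P.root' j (y - x) ∧
      P.root' j x + t i * P.root' j (y - x) < ⌊P.root' j v⌋ + 1 := by
    intro j hj hji
    rw [← htd j hj]
    constructor
    · nlinarith [(hx1 j).1, hd j hj]
    · nlinarith [hlt j hj hji, hd j hj]
  have hval : ∀ j, j ≠ i → j ≠ P.reflectionPerm i i →
      (⌊P.root' j v⌋ : ℝ) < P.root' j x + t i * P.root' j (y - x) ∧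
      P.root' j x + t i * P.root' j (y - x) < ⌊P.root' j v⌋ + 1 := by
    intro j hji hji'
    rcases lt_trichotomy ⌊P.root' j v⌋ ⌊P.root' j y⌋ with h | h | h
    · exact hJval j h hji
    · have h1 := hx1 j
      have h2 := hy.floor_lt j
      have h3 := Int.lt_floor_add_one (P.root' j y)
      rw [← h] at h2 h3
      rw [map_sub]
      constructor <;> nlinarith
    · have h1 := hJval (P.reflectionPerm j j) (by
        simp only [J, Set.mem_ofPred_eq]
        rw [hv.floor_neg, hy.floor_neg]
        omega) (fun h => hji' (by rw [← h, neg_neg_index]))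
      rw [hv.floor_neg, root'_neg, root'_neg] at h1
      push_cast at h1
      constructor <;> linarith [h1.1, h1.2]
  have hev : ∀ᶠ s in 𝓝[>] (t i), ∀ j, j ≠ i → j ≠ P.reflectionPerm i i →
      (⌊P.root' j v⌋ : ℝ) < P.root' j x + s * P.root' j (y - x) ∧
      P.root' j x + s * P.root' j (y - x) < ⌊P.root' j v⌋ + 1 := by
    rw [eventually_all]
    intro j
    by_cases hj : j ≠ i ∧ j ≠ P.reflectionPerm i i
    · obtain ⟨h1, h2⟩ := hval j hj.1 hj.2
      filter_upwards [tendsto_add_mul_nhdsGT (t i) (P.root' j x) (P.root' j (y - x))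
        (Ioo_mem_nhds h1 h2)] with s hs _ _
      exact hs
    · exact Eventually.of_forall fun s h1 h2 => absurd ⟨h1, h2⟩ hj
  have hev' : ∀ᶠ s in 𝓝[>] (t i), P.root' i x + s * P.root' i (y - x) < ⌊P.root' i v⌋ + 2 := by
    refine tendsto_add_mul_nhdsGT (t i) (P.root' i x) (P.root' i (y - x)) (Iio_mem_nhds ?_)
    rw [htd i hi]; linarith
  obtain ⟨s, ⟨hs1, hs2⟩, hs3⟩ := ((hev.and hev').and self_mem_nhdsWithin).exists
  have hs3 : t i < s := hs3
  have hci : ((⌊P.root' i v⌋ + 1 : ℤ) : ℝ) < P.root' i (x + s • (y - x)) ∧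
      P.root' i (x + s • (y - x)) < (⌊P.root' i v⌋ + 1 : ℤ) + 1 := by
    rw [map_add, map_smul, smul_eq_mul]
    push_cast
    constructor
    · rw [← htd i hi]; nlinarith [hd i hi]
    · linarith
  have hcj : ∀ j, j ≠ i → j ≠ P.reflectionPerm i i →
      (⌊P.root' j v⌋ : ℝ) < P.root' j (x + s • (y - x)) ∧
      P.root' j (x + s • (y - x)) < ⌊P.root' j v⌋ + 1 := by
    intro j h1 h2
    rw [map_add, map_smul, smul_eq_mul]
    exact hs1 j h1 h2
  refine ⟨x + s • (y - x), i, isRegular_of_forall_between fun j => ?_, hi,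
    floor_eq_of_between hci, fun j h1 h2 => floor_eq_of_between (hcj j h1 h2)⟩
  by_cases h1 : j = i
  · exact ⟨_, h1 ▸ hci⟩
  by_cases h2 : j = P.reflectionPerm i i
  · refine ⟨-(⌊P.root' i v⌋ + 1) - 1, ?_⟩
    rw [h2, root'_neg]
    push_cast at hci ⊢
    constructor <;> linarith [hci.1, hci.2]
  · exact ⟨_, hcj j h1 h2⟩

variable [TopologicalSpace V] [IsTopologicalAddGroup V] [ContinuousSMul ℝ V] [T2Space V]
  [P.IsRootSystem]

/-- Induction on the number of hyperplanes separating a from v, removing one that bounds the alcove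
of v. -/
theorem exists_galleryDist (b : P.Base) {a : V} (ha : IsRegular P a) :
    ∀ (N : ℕ) (v : V), IsRegular P v →
      ∑ i ∈ posRoots b, (⌊P.root' i v⌋ - ⌊P.root' i a⌋).natAbs = N →
      ∃ n, GalleryDist b (cell P a) (cell P v) n := by
  intro N
  induction N with
  | zero =>
    intro v hv hN
    refine ⟨0, ?_⟩
    have : v ∈ cell P a := by
      rw [mem_cell_iff_isPos b ha]
      intro i hi
      have h1 := (Finset.sum_eq_zero_iff.1 hN) i (by simpa using hi)
      have h2 : ⌊P.root' i v⌋ = ⌊P.root' i a⌋ := by omega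
      rw [← h2]
      exact ⟨hv.floor_lt i, Int.lt_floor_add_one _⟩
    rw [cell_eq_of_mem this]
    exact GalleryDist.refl _ (isAlcove_cell b ha)
  | succ N ih =>
    intro v hv hN
    have hne : ∃ i ∈ posRoots b, (⌊P.root' i v⌋ - ⌊P.root' i a⌋).natAbs ≠ 0 := by
      by_contra! h
      rw [Finset.sum_eq_zero h] at hN
      omega
    have : ∃ i, ⌊P.root' i v⌋ < ⌊P.root' i a⌋ := by
      obtain ⟨i, -, hi⟩ := hne
      rcases lt_or_ge ⌊P.root' i v⌋ ⌊P.root' i a⌋ with h | h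
      · exact ⟨i, h⟩
      · refine ⟨P.reflectionPerm i i, ?_⟩
        rw [hv.floor_neg, ha.floor_neg]
        omega
    obtain ⟨i₀, hi₀⟩ := this
    obtain ⟨c, i, hc, hi, hci, hcj⟩ := exists_adjacent hv ha hi₀
    -- pass to the positive one of `± α`
    have hcj' : ∀ p, b.IsPos p → (p = i ∨ p = P.reflectionPerm i i) →
        ∀ k, b.IsPos k → k ≠ p → ⌊P.root' k c⌋ = ⌊P.root' k v⌋ := by
      intro p hp hpi k hk hkp
      have hkp' : k ≠ P.reflectionPerm p p := by
        rintro rfl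
        exact (isPos_neg_iff b p).1 hk hp
      rcases hpi with rfl | rfl
      · exact hcj k hkp hkp'
      · rw [neg_neg_index] at hkp'
        exact hcj k hkp' hkp
    have hsum : ∀ p, b.IsPos p → (p = i ∨ p = P.reflectionPerm i i) →
        (⌊P.root' p v⌋ - ⌊P.root' p a⌋).natAbs = (⌊P.root' p c⌋ - ⌊P.root' p a⌋).natAbs + 1 →
        ∃ n, GalleryDist b (cell P a) (cell P c) n := by
      intro p hp hpi hpn
      apply ih c hc
      have hpm : p ∈ posRoots b := by simpa using hp
      classical
      rw [← Finset.add_sum_erase _ _ hpm] at hN ⊢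
      rw [Finset.sum_congr rfl (g := fun k => (⌊P.root' k v⌋ - ⌊P.root' k a⌋).natAbs)]
      · omega
      · intro k hk
        simp only [Finset.mem_erase, mem_posRoots] at hk
        rw [hcj' p hp hpi k hk.2 hk.1]
    by_cases hpos : b.IsPos i
    · obtain ⟨n, hn⟩ := hsum i hpos (Or.inl rfl) (by omega)
      refine ⟨n - 1, hn.down (stepUp_of_floor hv hc hpos hci (hcj' i hpos (Or.inl rfl)))⟩
    · have hpos' := (isPos_neg_iff b i).2 hpos
      obtain ⟨n, hn⟩ := hsum _ hpos' (Or.inr rfl) (by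
        rw [hv.floor_neg, hc.floor_neg, ha.floor_neg]; omega)
      refine ⟨n + 1, hn.up (stepUp_of_floor hc hv hpos' ?_ ?_)⟩
      · rw [hv.floor_neg, hc.floor_neg]; omega
      · intro k hk hki
        exact (hcj' _ hpos' (Or.inr rfl) k hk hki).symm

theorem StepUp.floorSum {b : P.Base} {v w : V} (hv : IsRegular P v) (hw : IsRegular P w)
    (h : StepUp b (cell P v) (cell P w)) : floorSum b w = floorSum b v + 1 := by
  classical
  obtain ⟨i, hi, h1, h2⟩ := h.floor hv hw
  have him : i ∈ posRoots b := by simpa using hi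
  rw [SemiInfinite.floorSum, SemiInfinite.floorSum, ← Finset.add_sum_erase _ _ him,
    ← Finset.add_sum_erase _ _ him, h1,
    Finset.sum_congr rfl (g := fun k => ⌊P.root' k v⌋)]
  · ring
  · intro k hk
    simp only [Finset.mem_erase, mem_posRoots] at hk
    exact h2 k hk.2 hk.1

theorem GalleryDist.eq_floorSum_sub {b : P.Base} {A B : Set V} {n : ℤ}
    (h : GalleryDist b A B n) :
    ∃ v w, IsRegular P v ∧ IsRegular P w ∧ A = cell P v ∧ B = cell P w ∧
      n = floorSum b w - floorSum b v := by
  induction h with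
  | refl hA =>
    obtain ⟨v, hv, rfl⟩ := hA.exists_eq_cell
    exact ⟨v, v, hv, hv, rfl, rfl, by ring⟩
  | up _ hs ih =>
    obtain ⟨v, w, hv, hw, rfl, rfl, rfl⟩ := ih
    obtain ⟨u, hu, rfl⟩ := hs.2.1.exists_eq_cell
    exact ⟨v, u, hv, hu, rfl, rfl, by rw [hs.floorSum hw hu]; ring⟩
  | down _ hs ih =>
    obtain ⟨v, w, hv, hw, rfl, rfl, rfl⟩ := ih
    obtain ⟨u, hu, rfl⟩ := hs.1.exists_eq_cell
    exact ⟨v, u, hv, hu, rfl, rfl, by rw [hs.floorSum hu hw]; ring⟩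

/-- Every gallery telescopes to the same difference, so the choice made in `signedDist` is
immaterial. -/
theorem signedDist_cell (b : P.Base) {v w : V} (hv : IsRegular P v) (hw : IsRegular P w) :
    signedDist b (cell P v) (cell P w) = floorSum b w - floorSum b v := by
  have hex : ∃ n, GalleryDist b (cell P v) (cell P w) n := exists_galleryDist b hv _ w hw rfl
  rw [signedDist, dif_pos hex]
  obtain ⟨v', w', -, -, h1, h2, h3⟩ := hex.choose_spec.eq_floorSum_sub
  have h4 : v ∈ cell P v' := h1 ▸ mem_cell_self hv
  have h5 : w ∈ cell P w' := h2 ▸ mem_cell_self hw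
  rw [h3, floorSum_eq_of_mem_cell b h4, floorSum_eq_of_mem_cell b h5]

/-- `signedDist` is 0 by default when there is no gallery, so a nonzero value yields one. -/
theorem exists_isAlcove_of_signedDist_ne_zero {b : P.Base} {A B : Set V}
    (h : signedDist b A B ≠ 0) : ∃ v, IsRegular P v ∧ A = cell P v := by
  by_cases hex : ∃ n, GalleryDist b A B n
  · obtain ⟨n, hn⟩ := hex
    obtain ⟨v, -, hv, -, h1, -⟩ := hn.eq_floorSum_sub
    exact ⟨v, hv, h1⟩
  · exact absurd (dif_neg hex) h

end Galleries

/-! ### The right action, heights of alcoves and the order -/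

section Action

variable {ι M V : Type*} [AddCommGroup M] [Module ℝ M] [AddCommGroup V] [Module ℝ V]
  {P : RootPairing ι ℝ M V}

/-- The right action `v ↦ cl(w)⁻¹ v + wt(w)` of the affine Weyl group on points. -/
def act (w : affineWeylGroup P) (v : V) : V := (cl w).symm v + wt w

/-- The right action is inversion conjugated by -1. This gives multiplicativity, and explains why
s_{α+mδ}, a reflection in F_{α,-m} as an affine map, acts on the right by the reflection in F_{α,m}.
-/
theorem act_eq_neg_inv (w : affineWeylGroup P) (v : V) :
    act w v = -((w : V ≃ᵃ[ℝ] V)⁻¹ (-v)) := by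
  have h : (w : V ≃ᵃ[ℝ] V) (-(act w v)) = -v := by
    have h1 := (w : V ≃ᵃ[ℝ] V).map_vadd 0 (-(act w v))
    simp only [vadd_eq_add, add_zero] at h1
    rw [h1]
    change cl w (-(act w v)) + _ = _
    simp [act, wt]
  rw [← h]
  simp [AffineEquiv.inv_def]

theorem act_mul (u w : affineWeylGroup P) (v : V) : act (u * w) v = act w (act u v) := by
  simp only [act_eq_neg_inv, Subgroup.coe_mul, mul_inv_rev, neg_neg]
  rfl

theorem act_one (v : V) : act (1 : affineWeylGroup P) v = v := by
  simp [act_eq_neg_inv]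

theorem affineReflection_apply (i : ι) (m : ℤ) (v : V) :
    (affineReflection P i m : V ≃ᵃ[ℝ] V) v = affRefl P i (-m) v := by
  simp only [affineReflection, AffineEquiv.mul_def, AffineEquiv.trans_apply,
    AffineEquiv.constVAdd_apply, vadd_eq_add, LinearEquiv.coe_toAffineEquiv, affRefl,
    RootPairing.coreflection_apply, map_add, map_smul, ← Int.cast_smul_eq_zsmul ℝ]
  have h : P.toLinearMap (P.root i) (P.coroot i) = 2 := P.root_coroot_two i
  simp only [RootPairing.root', h]
  push_cast
  module

theorem affineReflection_mul_self (i : ι) (m : ℤ) :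
    affineReflection P i m * affineReflection P i m = 1 := by
  apply Subtype.ext
  ext v
  simp only [Subgroup.coe_mul, AffineEquiv.mul_def, AffineEquiv.trans_apply,
    affineReflection_apply, affRefl_affRefl, Subgroup.coe_one, AffineEquiv.one_def,
    AffineEquiv.refl_apply]

theorem affineReflection_inv (i : ι) (m : ℤ) :
    (affineReflection P i m)⁻¹ = affineReflection P i m :=
  inv_eq_of_mul_eq_one_left (affineReflection_mul_self i m)

theorem affineReflection_neg (i : ι) (m : ℤ) :
    affineReflection P (P.reflectionPerm i i) (-m) = affineReflection P i m := by
  apply Subtype.ext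
  ext v
  rw [affineReflection_apply, affineReflection_apply, affRefl_neg]

theorem act_affineReflection (i : ι) (m : ℤ) (v : V) :
    act (affineReflection P i m) v = affRefl P i m v := by
  rw [act_eq_neg_inv, ← Subgroup.coe_inv, affineReflection_inv, affineReflection_apply]
  simp only [affRefl, map_neg]
  push_cast
  module

theorem act_mul_affineReflection (w : affineWeylGroup P) (i : ι) (m : ℤ) (v : V) :
    act (w * affineReflection P i m) v = affRefl P i m (act w v) := by
  rw [act_mul, act_affineReflection]

theorem exists_int_root'_of_mem_corootLattice [P.IsCrystallographic] (i : ι) {lam : V}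
    (h : lam ∈ corootLattice P) : ∃ n : ℤ, P.root' i lam = n := by
  induction h using AddSubgroup.closure_induction with
  | mem x hx =>
    obtain ⟨j, rfl⟩ := hx
    exact exists_int_pairing P i j
  | zero => exact ⟨0, by simp⟩
  | add x y _ _ hx hy =>
    obtain ⟨m, hm⟩ := hx
    obtain ⟨n, hn⟩ := hy
    exact ⟨m + n, by rw [map_add, hm, hn]; push_cast; ring⟩
  | neg x _ hx =>
    obtain ⟨m, hm⟩ := hx
    exact ⟨-m, by rw [map_neg, hm]; push_cast; ring⟩

/-- Group elements permute the roots up to integer shifts. The inverse is included so that the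
induction closes. -/
theorem exists_root'_apply [P.IsCrystallographic] {x : V ≃ᵃ[ℝ] V} (hx : x ∈ affineWeylGroup P) :
    (∀ i, ∃ j, ∃ n : ℤ, ∀ v, P.root' i (x v) = P.root' j v + n) ∧
      ∀ i, ∃ j, ∃ n : ℤ, ∀ v, P.root' i (x⁻¹ v) = P.root' j v + n := by
  induction hx using Subgroup.closure_induction with
  | mem x hx =>
    rcases hx with ⟨k, rfl⟩ | ⟨lam, hlam, rfl⟩
    · have h : ∀ i, ∃ j, ∃ n : ℤ, ∀ v,
          P.root' i ((P.coreflection k).toAffineEquiv v) = P.root' j v + n := fun i =>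
        ⟨P.reflectionPerm k i, 0, fun v => by simpa using root'_coreflection P k i v⟩
      refine ⟨h, ?_⟩
      have h2 : ((P.coreflection k).toAffineEquiv)⁻¹ = (P.coreflection k).toAffineEquiv := by
        rw [inv_eq_iff_mul_eq_one]
        ext v
        simp [AffineEquiv.mul_def]
      rw [h2]
      exact h
    · refine ⟨fun i => ?_, fun i => ?_⟩
      · obtain ⟨n, hn⟩ := exists_int_root'_of_mem_corootLattice i hlam
        exact ⟨i, n, fun v => by simp [hn, add_comm]⟩
      · obtain ⟨n, hn⟩ := exists_int_root'_of_mem_corootLattice i hlam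
        exact ⟨i, -n, fun v => by simp [AffineEquiv.inv_def, hn]; ring⟩
  | one => exact ⟨fun i => ⟨i, 0, by simp⟩, fun i => ⟨i, 0, by simp⟩⟩
  | mul x y _ _ hx hy =>
    refine ⟨fun i => ?_, fun i => ?_⟩
    · obtain ⟨j, n, h⟩ := hx.1 i
      obtain ⟨k, m, h'⟩ := hy.1 j
      refine ⟨k, m + n, fun v => ?_⟩
      rw [AffineEquiv.mul_def, AffineEquiv.trans_apply, h, h']
      push_cast; ring
    · obtain ⟨j, n, h⟩ := hy.2 i
      obtain ⟨k, m, h'⟩ := hx.2 j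
      refine ⟨k, m + n, fun v => ?_⟩
      rw [mul_inv_rev, AffineEquiv.mul_def, AffineEquiv.trans_apply, h, h']
      push_cast; ring
  | inv x _ hx => exact ⟨hx.2, by simpa using hx.1⟩

theorem exists_root'_act [P.IsCrystallographic] (w : affineWeylGroup P) (i : ι) :
    ∃ j, ∃ n : ℤ, ∀ v, P.root' i (act w v) = P.root' j v + n := by
  obtain ⟨j, n, h⟩ := (exists_root'_apply w.2).2 i
  refine ⟨j, -n, fun v => ?_⟩
  rw [act_eq_neg_inv, map_neg, h, map_neg]
  push_cast; ring

theorem IsRegular.act [P.IsCrystallographic] {v : V} (hv : IsRegular P v)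
    (w : affineWeylGroup P) : IsRegular P (act w v) := by
  intro i m hm
  obtain ⟨j, n, h⟩ := exists_root'_act w i
  refine hv j (m - n) ?_
  rw [h] at hm
  push_cast
  linarith

theorem act_mem_cell [P.IsCrystallographic] {u v : V} (w : affineWeylGroup P)
    (hu : u ∈ cell P v) : SemiInfinite.act w u ∈ cell P (SemiInfinite.act w v) := by
  refine ⟨hu.1.act w, fun i => ?_⟩
  obtain ⟨j, n, h⟩ := exists_root'_act w i
  rw [h, h, Int.floor_add_intCast, Int.floor_add_intCast, hu.2]

theorem rightAct_cell [P.IsCrystallographic] (w : affineWeylGroup P) (v : V) :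
    rightAct (cell P v) w = cell P (act w v) := by
  change act w '' cell P v = _
  apply Set.Subset.antisymm
  · rintro _ ⟨u, hu, rfl⟩
    exact act_mem_cell w hu
  · intro u hu
    refine ⟨act w⁻¹ u, ?_, ?_⟩
    · have := act_mem_cell w⁻¹ hu
      rwa [← act_mul, mul_inv_cancel, act_one] at this
    · rw [← act_mul, inv_mul_cancel, act_one]

theorem isRegular_of_mem_baseAlcove {b : P.Base} {v : V} (hv : v ∈ baseAlcove b) :
    IsRegular P v := by
  apply isRegular_of_forall_between
  intro i
  by_cases hi : b.IsPos i
  · exact ⟨-1, by simpa using hv i hi⟩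
  · have := hv _ ((isPos_neg_iff b i).2 hi)
    rw [root'_neg] at this
    exact ⟨0, by push_cast; constructor <;> linarith [this.1, this.2]⟩

theorem baseAlcove_eq_cell {b : P.Base} {v : V} (hv : v ∈ baseAlcove b) :
    baseAlcove b = cell P v := by
  ext u
  rw [mem_cell_iff_isPos b (isRegular_of_mem_baseAlcove hv)]
  refine forall₂_congr fun i hi => ?_
  have h : ⌊P.root' i v⌋ = -1 := floor_eq_of_between (by simpa using hv i hi)
  rw [h]
  norm_num

theorem exists_isPos_affineReflection_eq (b : P.Base) (i : ι) (m : ℤ) :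
    ∃ j n, b.IsPos j ∧ affineReflection P i m = affineReflection P j n := by
  by_cases hi : b.IsPos i
  · exact ⟨i, m, hi, rfl⟩
  · exact ⟨_, _, (isPos_neg_iff b i).2 hi, (affineReflection_neg i m).symm⟩

/-- One of ±(α + mδ) is positive and both give the same reflection, so positivity does not restrict
the steps of the order. -/
theorem exists_isPosAffineRoot_affineReflection_eq (b : P.Base) (i : ι) (m : ℤ) :
    ∃ j n, IsPosAffineRoot b j n ∧ affineReflection P i m = affineReflection P j n := by
  obtain ⟨i, m, hi, h⟩ := exists_isPos_affineReflection_eq b i m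
  rw [h]
  rcases le_or_gt 0 m with hm | hm
  · exact ⟨i, m, Or.inl ⟨hi, hm⟩, rfl⟩
  · refine ⟨_, _, Or.inr ⟨?_, ?_⟩, (affineReflection_neg i m).symm⟩
    · rw [isPos_neg_iff]; exact not_not.2 hi
    · omega

theorem baseAlcove_nonempty_of_semiInfLength_ne_zero [Finite ι] [TopologicalSpace V]
    [IsTopologicalAddGroup V] [ContinuousSMul ℝ V] [T2Space V] [P.IsRootSystem] [P.IsReduced]
    {b : P.Base} {y w : affineWeylGroup P}
    (h : semiInfLength b y w ≠ 0) : (baseAlcove b).Nonempty := by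
  obtain ⟨v, hv, h1⟩ := exists_isAlcove_of_signedDist_ne_zero h
  have h2 : v ∈ rightAct (baseAlcove b) y := h1 ▸ mem_cell_self hv
  obtain ⟨u, hu, -⟩ := h2
  exact ⟨u, hu⟩

/-- The height of the alcove `A⁻ · w`, read off at the point `v ∈ A⁻`. -/
noncomputable def alcoveHeight [Finite ι] (b : P.Base) (v : V) (w : affineWeylGroup P) : ℤ :=
  floorSum b (act w v)

/-- `u` and `w` differ by a reflection, and `w` is higher. -/
def Ascends [Finite ι] (b : P.Base) (v : V) (u w : affineWeylGroup P) : Prop :=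
  (∃ i m, w = u * affineReflection P i m) ∧ alcoveHeight b v u < alcoveHeight b v w

theorem alcoveHeight_le_of_reflTransGen [Finite ι] {b : P.Base} {v : V} {y w : affineWeylGroup P}
    (h : Relation.ReflTransGen (Ascends b v) y w) : alcoveHeight b v y ≤ alcoveHeight b v w := by
  induction h with
  | refl => rfl
  | tail _ h ih => exact ih.trans h.2.le

variable [Finite ι] [P.IsCrystallographic]

theorem alcoveHeight_lt_mul_affineReflection {b : P.Base} {v : V} (hv : v ∈ baseAlcove b)
    (w : affineWeylGroup P) {i : ι} (hi : b.IsPos i) {m : ℤ} (h : P.root' i (act w v) < m) :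
    alcoveHeight b v w < alcoveHeight b v (w * affineReflection P i m) := by
  rw [alcoveHeight, alcoveHeight, act_mul_affineReflection]
  exact floorSum_lt_affRefl hv hi ((isRegular_of_mem_baseAlcove hv).act w) h

theorem odd_alcoveHeight_mul_affineReflection_sub [P.IsReduced] {b : P.Base} {v : V} (hv : v ∈ baseAlcove b)
    (w : affineWeylGroup P) (i : ι) (m : ℤ) :
    Odd (alcoveHeight b v (w * affineReflection P i m) - alcoveHeight b v w) := by
  obtain ⟨j, n, hj, h⟩ := exists_isPos_affineReflection_eq b i m
  rw [h, alcoveHeight, alcoveHeight, act_mul_affineReflection]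
  exact odd_floorSum_affRefl_sub b hj n ((isRegular_of_mem_baseAlcove hv).act w)

variable [TopologicalSpace V] [IsTopologicalAddGroup V] [ContinuousSMul ℝ V] [T2Space V]
  [P.IsRootSystem] [P.IsReduced]

theorem semiInfLength_eq_alcoveHeight_sub {b : P.Base} {v : V} (hv : v ∈ baseAlcove b)
    (y w : affineWeylGroup P) :
    semiInfLength b y w = alcoveHeight b v w - alcoveHeight b v y := by
  have h := isRegular_of_mem_baseAlcove hv
  rw [semiInfLength, baseAlcove_eq_cell hv, rightAct_cell, rightAct_cell,
    signedDist_cell b (h.act y) (h.act w)]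
  rfl

theorem semiInfLE_iff {b : P.Base} {v : V} (hv : v ∈ baseAlcove b) (y w : affineWeylGroup P) :
    semiInfLE b y w ↔ Relation.ReflTransGen (Ascends b v) y w := by
  have : (fun u w : affineWeylGroup P => ∃ i, ∃ m : ℤ, IsPosAffineRoot b i m ∧
      w = u * affineReflection P i m ∧ 0 < semiInfLength b u w) = Ascends b v := by
    ext u w
    constructor
    · rintro ⟨i, m, -, h1, h2⟩
      rw [semiInfLength_eq_alcoveHeight_sub hv] at h2
      exact ⟨⟨i, m, h1⟩, by omega⟩
    · rintro ⟨⟨i, m, h1⟩, h2⟩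
      obtain ⟨j, n, h3, h4⟩ := exists_isPosAffineRoot_affineReflection_eq b i m
      refine ⟨j, n, h3, h4 ▸ h1, ?_⟩
      rw [semiInfLength_eq_alcoveHeight_sub hv]
      omega
  rw [semiInfLE, this]

theorem semiInfLT_iff_of_alcoveHeight_le {b : P.Base} {v : V} (hv : v ∈ baseAlcove b)
    {y z : affineWeylGroup P} (h : alcoveHeight b v z ≤ alcoveHeight b v y + 1) :
    semiInfLT b y z ↔ Ascends b v y z := by
  rw [semiInfLT, semiInfLE_iff hv]
  constructor
  · rintro ⟨h1, h2⟩
    rcases Relation.ReflTransGen.cases_head h1 with h3 | ⟨u, hu, huz⟩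
    · exact absurd h3 h2
    · rcases Relation.ReflTransGen.cases_head huz with rfl | ⟨u', hu', huz'⟩
      · exact hu
      · have := alcoveHeight_le_of_reflTransGen huz'
        have := hu.2
        have := hu'.2
        omega
  · intro h1
    exact ⟨Relation.ReflTransGen.single h1, fun h2 => by have := h1.2; rw [h2] at this; omega⟩

theorem alcoveHeight_lt_of_semiInfLT {b : P.Base} {v : V} (hv : v ∈ baseAlcove b)
    {y z : affineWeylGroup P} (h : semiInfLT b y z) : alcoveHeight b v y < alcoveHeight b v z := by
  obtain ⟨h1, h2⟩ := h
  rw [semiInfLE_iff hv] at h1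
  rcases Relation.ReflTransGen.cases_head h1 with h3 | ⟨u, hu, huz⟩
  · exact absurd h3 h2
  · exact hu.2.trans_le (alcoveHeight_le_of_reflTransGen huz)

theorem setOf_semiInfLT_eq {b : P.Base} {v : V} (hv : v ∈ baseAlcove b)
    {y w : affineWeylGroup P} (h : alcoveHeight b v w = alcoveHeight b v y + 2) :
    {z | semiInfLT b y z ∧ semiInfLT b z w} = {z | Ascends b v y z ∧ Ascends b v z w} := by
  ext z
  constructor
  · rintro ⟨h1, h2⟩
    have h3 := alcoveHeight_lt_of_semiInfLT hv h1
    have h4 := alcoveHeight_lt_of_semiInfLT hv h2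
    exact ⟨(semiInfLT_iff_of_alcoveHeight_le hv (by omega)).1 h1,
      (semiInfLT_iff_of_alcoveHeight_le hv (by omega)).1 h2⟩
  · rintro ⟨h1, h2⟩
    have h3 := h1.2
    have h4 := h2.2
    exact ⟨(semiInfLT_iff_of_alcoveHeight_le hv (by omega)).2 h1,
      (semiInfLT_iff_of_alcoveHeight_le hv (by omega)).2 h2⟩

/-- A chain of one step would have odd rise, and three or more steps would rise by at least three.
-/
theorem exists_ascends_ascends {b : P.Base} {v : V} (hv : v ∈ baseAlcove b)
    {y w : affineWeylGroup P} (h : alcoveHeight b v w = alcoveHeight b v y + 2)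
    (hle : semiInfLE b y w) : ∃ z, Ascends b v y z ∧ Ascends b v z w := by
  rw [semiInfLE_iff hv] at hle
  rcases Relation.ReflTransGen.cases_head hle with rfl | ⟨z, hz, hzw⟩
  · omega
  rcases Relation.ReflTransGen.cases_head hzw with rfl | ⟨u, hu, huw⟩
  · obtain ⟨⟨i, m, rfl⟩, -⟩ := hz
    have := odd_alcoveHeight_mul_affineReflection_sub hv y i m
    rw [h] at this
    norm_num [Int.odd_iff] at this
  rcases Relation.ReflTransGen.cases_head huw with rfl | ⟨u', hu', huw'⟩
  · exact ⟨z, hz, hu⟩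
  · have := alcoveHeight_le_of_reflTransGen huw'
    have := hz.2
    have := hu.2
    have := hu'.2
    omega

end Action

/-! ### Planar root systems in counterclockwise order -/

/-- A family of vectors in the real plane, given by their coordinates, that is closed under
negation, spans the plane, and contains no other proportional vectors. -/
structure PlanarRoots (T : Type*) where
  /-- the first coordinate -/
  x : T → ℝ
  /-- the second coordinate -/
  y : T → ℝ
  /-- the negation -/
  neg : T → T
  x_neg : ∀ a, x (neg a) = -x a
  y_neg : ∀ a, y (neg a) = -y a
  neg_neg : ∀ a, neg (neg a) = a
  eq_or_eq_neg : ∀ a b, x a * y b - y a * x b = 0 → b = a ∨ b = neg a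
  exists_area_ne_zero : ∀ a, ∃ b, x a * y b - y a * x b ≠ 0

namespace PlanarRoots

variable {T : Type*} (R : PlanarRoots T)

/-- The oriented area of the parallelogram spanned by two vectors. -/
def area (a b : T) : ℝ := R.x a * R.y b - R.y a * R.x b

theorem area_neg_left (a b : T) : R.area (R.neg a) b = -R.area a b := by
  simp only [area, x_neg, y_neg]; ring

theorem area_neg_right (a b : T) : R.area a (R.neg b) = -R.area a b := by
  simp only [area, x_neg, y_neg]; ring

theorem area_swap (a b : T) : R.area a b = -R.area b a := by
  simp only [area]; ring

theorem area_self (a : T) : R.area a a = 0 := by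
  simp only [area]; ring

theorem exists_area_pos (a : T) : ∃ b, 0 < R.area a b := by
  obtain ⟨b, hb⟩ := R.exists_area_ne_zero a
  rcases lt_or_gt_of_ne hb with h | h
  · refine ⟨R.neg b, ?_⟩
    rw [area_neg_right]
    exact neg_pos.2 h
  · exact ⟨b, h⟩

/-- `b` is the next vector after `a` in counterclockwise order. -/
def IsNext (a b : T) : Prop := 0 < R.area a b ∧ ∀ c, 0 < R.area a c → R.area c b ≤ 0

/-- By the Plücker relation `hpl`, the ratio area(d, b) / area(a, b) grows with the angle from a to
b, so its minimum is the next vector. -/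
theorem exists_isNext [Finite T] (a : T) : ∃ b, R.IsNext a b := by
  obtain ⟨d, hd⟩ := R.exists_area_pos a
  obtain ⟨b, hb, hmin⟩ := Set.exists_min_image {b | 0 < R.area a b}
    (fun b => R.area d b / R.area a b) (Set.toFinite _) ⟨d, hd⟩
  refine ⟨b, hb, fun c hc => ?_⟩
  have hb' : 0 < R.area a b := hb
  have h := hmin c hc
  rw [div_le_div_iff₀ hb' hc] at h
  have hpl : R.area d c * R.area a b - R.area d b * R.area a c = -R.area a d * R.area c b := by
    simp only [area]; ring
  by_contra! hpos
  nlinarith [mul_pos hd hpos]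

variable {R}

theorem IsNext.right_unique {a b b' : T} (h : R.IsNext a b) (h' : R.IsNext a b') : b = b' := by
  have h1 := h'.2 b h.1
  have h2 := h.2 b' h'.1
  rw [R.area_swap] at h2
  rcases R.eq_or_eq_neg b b' (le_antisymm h1 (neg_nonpos.1 h2)) with h3 | h3
  · exact h3.symm
  · have h4 := h'.1
    rw [h3, area_neg_right] at h4
    linarith [h.1]

theorem IsNext.left_unique {a a' b : T} (h : R.IsNext a b) (h' : R.IsNext a' b) : a = a' := by
  have h1 : R.area a a' ≤ 0 := by
    by_contra! hpos
    linarith [h.2 a' hpos, h'.1]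
  have h2 : R.area a' a ≤ 0 := by
    by_contra! hpos
    linarith [h'.2 a hpos, h.1]
  rw [R.area_swap] at h2
  rcases R.eq_or_eq_neg a a' (le_antisymm h1 (neg_nonpos.1 h2)) with h3 | h3
  · exact h3.symm
  · have h4 := h'.1
    rw [h3, area_neg_left] at h4
    linarith [h.1]

theorem IsNext.neg {a b : T} (h : R.IsNext a b) : R.IsNext (R.neg a) (R.neg b) := by
  refine ⟨by rw [area_neg_left, area_neg_right, _root_.neg_neg]; exact h.1, fun c hc => ?_⟩
  have h1 := h.2 (R.neg c) (by rw [area_neg_right, ← area_neg_left]; exact hc)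
  rwa [area_neg_left, ← area_neg_right] at h1

theorem IsNext.map {a b : T} (h : R.IsNext a b) {σ : T → T} (hσ : Function.Involutive σ)
    (harea : ∀ a b, R.area (σ a) (σ b) = -R.area a b) : R.IsNext (σ b) (σ a) := by
  refine ⟨by rw [harea, ← R.area_swap]; exact h.1, fun c hc => ?_⟩
  rw [← hσ c, harea, ← R.area_swap] at hc ⊢
  by_contra! h1
  linarith [h.2 _ h1]

/-- Otherwise a negative value would be followed by negative values forever, against f (t + k) = -f
t. -/
theorem exists_sign_change {f : ℤ → ℝ} {k : ℕ} (hf : ∀ t, f (t + k) = -f t)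
    (hne : ∀ t, f t ≠ 0) : ∃ t, f t < 0 ∧ 0 < f (t + 1) := by
  by_contra! h
  have h' : ∀ t, f t < 0 → f (t + 1) < 0 := fun t ht => lt_of_le_of_ne (h t ht) (hne _)
  obtain ⟨t, ht⟩ : ∃ t, f t < 0 := by
    rcases lt_or_gt_of_ne (hne 0) with h0 | h0
    · exact ⟨0, h0⟩
    · exact ⟨0 + k, by rw [hf]; linarith⟩
  have h2 : ∀ n : ℕ, f (t + n) < 0 := by
    intro n
    induction n with
    | zero => simpa using ht
    | succ n ih =>
      have := h' _ ih
      rwa [add_assoc] at this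
  have := h2 k
  rw [hf] at this
  linarith

/-- A linear form that vanishes at no vector is positive on one half of the list. -/
theorem exists_forall_pos {k : ℕ} {γ : ℤ → T} (hneg : ∀ t, γ (t + k) = R.neg (γ t))
    (harea : ∀ t j : ℤ, 0 < j → j < k → 0 < R.area (γ t) (γ (t + j))) {f : T → ℝ}
    {A B : ℝ} (hf : ∀ a, f a = A * R.x a + B * R.y a) (hne : ∀ a, f a ≠ 0) :
    ∃ p : ℤ, ∀ i, p < i → i ≤ p + k → 0 < f (γ i) := by
  have hfneg : ∀ a, f (R.neg a) = -f a := by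
    intro a; rw [hf, hf, R.x_neg, R.y_neg]; ring
  obtain ⟨p, h1, h2⟩ := exists_sign_change (f := fun t => f (γ t)) (k := k)
    (fun t => by rw [hneg, hfneg]) (fun t => hne _)
  refine ⟨p, fun i hi1 hi2 => ?_⟩
  rcases hi2.lt_or_eq with hi2 | rfl
  · rcases eq_or_lt_of_le (show p + 1 ≤ i by omega) with rfl | hi3
    · exact h2
    have e1 := harea p 1 one_pos (by omega)
    have e2 := harea p (i - p) (by omega) (by omega)
    have e3 := harea (p + 1) (i - (p + 1)) (by omega) (by omega)
    rw [add_sub_cancel] at e2 e3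
    -- Cramer's rule for γ i in terms of γ p and γ (p + 1), between which f changes sign.
    have key : R.area (γ p) (γ (p + 1)) * f (γ i) =
        -R.area (γ (p + 1)) (γ i) * f (γ p) + R.area (γ p) (γ i) * f (γ (p + 1)) := by
      simp only [hf, area]; ring
    by_contra! hneg'
    nlinarith [mul_pos e2 h2, mul_pos e3 (neg_pos.2 h1)]
  · rw [hneg, hfneg]; linarith

variable (R) [Finite T]

/-- The next vector in counterclockwise order. -/
noncomputable def next : Equiv.Perm T :=
  Equiv.ofBijective (fun a => (R.exists_isNext a).choose) <| Finite.injective_iff_bijective.1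
    fun a a' h => (R.exists_isNext a).choose_spec.left_unique
      (by simpa only [h] using (R.exists_isNext a').choose_spec)

theorem isNext_next (a : T) : R.IsNext a (R.next a) := (R.exists_isNext a).choose_spec

theorem next_zpow_add (m n : ℤ) (a : T) : (R.next ^ (m + n)) a = (R.next ^ m) ((R.next ^ n) a) := by
  rw [zpow_add, Equiv.Perm.mul_apply]

theorem next_zpow_neg (n : ℤ) (a : T) : (R.next ^ n) (R.neg a) = R.neg ((R.next ^ n) a) := by
  let N : Equiv.Perm T := Function.Involutive.toPerm R.neg R.neg_neg
  have h : Commute R.next N :=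
    Equiv.ext fun a => (R.isNext_next (R.neg a)).right_unique (R.isNext_next a).neg
  exact congrArg (fun e : Equiv.Perm T => e a) (h.zpow_left n).eq

theorem map_next_zpow {σ : T → T} (hσ : Function.Involutive σ)
    (harea : ∀ a b, R.area (σ a) (σ b) = -R.area a b) (n : ℤ) (a : T) :
    σ ((R.next ^ n) a) = (R.next ^ (-n)) (σ a) := by
  let N : Equiv.Perm T := Function.Involutive.toPerm σ hσ
  have h : SemiconjBy N R.next R.next⁻¹ := by
    refine Equiv.ext fun a => ?_
    have h1 := (R.isNext_next a).map hσ harea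
    have h2 := (R.isNext_next _).right_unique h1
    rw [Equiv.Perm.mul_apply, Equiv.Perm.mul_apply, Equiv.Perm.eq_inv_iff_eq]
    exact h2
  have h3 := (h.zpow_right n).eq
  rw [inv_zpow, ← zpow_neg] at h3
  exact congrArg (fun e : Equiv.Perm T => e a) h3

/-- The successors of a stay strictly to its left until -a is reached, since the next vector cannot
jump over -a. As `next` has finite order, -a is reached. -/
theorem exists_half_period (a : T) : ∃ k : ℕ, 0 < k ∧ (R.next ^ (k : ℤ)) a = R.neg a ∧
    ∀ j : ℕ, 0 < j → j < k → 0 < R.area a ((R.next ^ (j : ℤ)) a) := by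
  classical
  have step : ∀ n : ℕ, (∃ k : ℕ, 0 < k ∧ k ≤ n ∧ (R.next ^ (k : ℤ)) a = R.neg a) ∨
      ∀ j : ℕ, 0 < j → j ≤ n → 0 < R.area a ((R.next ^ (j : ℤ)) a) := by
    intro n
    induction n with
    | zero => exact Or.inr fun j h1 h2 => by omega
    | succ n ih =>
      rcases ih with ⟨k, h1, h2, h3⟩ | ih
      · exact Or.inl ⟨k, h1, by omega, h3⟩
      have hnext := R.isNext_next ((R.next ^ (n : ℤ)) a)
      have hs : R.next ((R.next ^ (n : ℤ)) a) = (R.next ^ ((n + 1 : ℕ) : ℤ)) a := by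
        rw [Nat.cast_succ, add_comm, next_zpow_add, zpow_one]
      rw [hs] at hnext
      have hpos : R.area a ((R.next ^ ((n + 1 : ℕ) : ℤ)) a) > 0 ∨
          (R.next ^ ((n + 1 : ℕ) : ℤ)) a = R.neg a := by
        rcases Nat.eq_zero_or_pos n with rfl | hn
        · left
          have := (R.isNext_next a).1
          simpa using this
        · have h1 := ih n hn le_rfl
          have h2 := hnext.2 (R.neg a) (by
            rw [area_neg_right, ← R.area_swap]; exact h1)
          rw [area_neg_left] at h2
          rcases h2.lt_or_eq with h3 | h3
          · left; linarith
          · rcases R.eq_or_eq_neg a _ (show R.area a _ = 0 by linarith) with h4 | h4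
            · exfalso
              rw [h4] at hnext
              have := hnext.1
              rw [R.area_swap] at this
              linarith
            · exact Or.inr h4
      rcases hpos with hpos | hpos
      · right
        intro j h1 h2
        rcases Nat.lt_or_ge n j with h3 | h3
        · obtain rfl : j = n + 1 := by omega
          exact hpos
        · exact ih j h1 h3
      · exact Or.inl ⟨n + 1, by omega, le_rfl, hpos⟩
  have hex : ∃ k : ℕ, 0 < k ∧ (R.next ^ (k : ℤ)) a = R.neg a := by
    rcases step (orderOf R.next) with ⟨k, h1, -, h3⟩ | h
    · exact ⟨k, h1, h3⟩
    · have := h _ (orderOf_pos R.next) le_rfl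
      rw [zpow_natCast, pow_orderOf_eq_one, Equiv.Perm.one_apply, area_self] at this
      exact absurd this (lt_irrefl _)
  refine ⟨Nat.find hex, (Nat.find_spec hex).1, (Nat.find_spec hex).2, fun j h1 h2 => ?_⟩
  rcases step j with ⟨k, h3, h4, h5⟩ | h
  · exact absurd ⟨h3, h5⟩ (Nat.find_min hex (by omega))
  · exact h j h1 le_rfl

/-- The vectors can be listed in counterclockwise order as `γ t`, `t ∈ ℤ`, such that half a turn
is a shift by `k`, and such that orientation reversing symmetries reverse the list. -/
theorem exists_enumeration [Nonempty T] : ∃ (k : ℕ) (γ : ℤ → T), 0 < k ∧ Function.Surjective γ ∧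
    (∀ t, γ (t + k) = R.neg (γ t)) ∧
    (∀ t j : ℤ, 0 < j → j < k → 0 < R.area (γ t) (γ (t + j))) ∧
    ∀ σ : T → T, Function.Involutive σ → (∀ a b, R.area (σ a) (σ b) = -R.area a b) →
      ∀ s t, σ (γ t) = γ s → ∀ j, σ (γ (t + j)) = γ (s - j) := by
  obtain ⟨a⟩ := ‹Nonempty T›
  obtain ⟨k, hk, hka, hpos⟩ := R.exists_half_period a
  have hadd : ∀ t j : ℤ, (R.next ^ (t + j)) a = (R.next ^ t) ((R.next ^ j) a) :=
    fun t j => R.next_zpow_add t j a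
  have hadd' : ∀ t j : ℤ, (R.next ^ (t + j)) a = (R.next ^ j) ((R.next ^ t) a) :=
    fun t j => by rw [add_comm]; exact R.next_zpow_add j t a
  have hneg : ∀ t : ℤ, (R.next ^ (t + k)) a = R.neg ((R.next ^ t) a) := fun t => by
    rw [hadd, hka, next_zpow_neg]
  refine ⟨k, fun t => (R.next ^ t) a, hk, ?_, hneg, ?_, ?_⟩
  · intro b
    by_contra! hb
    have hne : ∀ t : ℤ, R.area b ((R.next ^ t) a) ≠ 0 := by
      intro t h0
      rcases R.eq_or_eq_neg _ _ h0 with h1 | h1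
      · exact hb t h1
      · exact hb (t + k) ((hneg t).trans (by rw [h1, R.neg_neg]))
    -- A vector missing from the list would lie strictly between two consecutive ones.
    obtain ⟨t, h1, h2⟩ := exists_sign_change (f := fun t : ℤ => R.area b ((R.next ^ t) a)) (k := k)
      (fun t => by rw [hneg, area_neg_right]) hne
    have h3 := R.isNext_next ((R.next ^ t) a)
    rw [show R.next ((R.next ^ t) a) = (R.next ^ (t + 1)) a by rw [hadd', zpow_one]] at h3
    have := h3.2 b (by rw [R.area_swap]; linarith)
    linarith
  · intro t j h1 h2
    obtain ⟨k', hk', hka', hpos'⟩ := R.exists_half_period ((R.next ^ t) a)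
    -- `next` commutes with negation and with its powers, so a half turn from γ t is also one from
    -- a.
    have hkk : (R.next ^ (k' : ℤ)) a = R.neg a := by
      rw [← next_zpow_neg, ← hadd', hadd] at hka'
      exact (R.next ^ t).injective hka'
    have hle : k ≤ k' := by
      by_contra! hlt
      have := hpos k' hk' hlt
      rw [hkk, area_neg_right, area_self] at this
      linarith
    have := hpos' j.toNat (by omega) (by omega)
    rw [← hadd'] at this
    rwa [Int.toNat_of_nonneg h1.le] at this
  · intro σ hσ harea s t hst j
    change σ ((R.next ^ t) a) = (R.next ^ s) a at hst
    change σ ((R.next ^ (t + j)) a) = (R.next ^ (s - j)) a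
    rw [hadd', R.map_next_zpow hσ harea, hst, ← hadd']
    rfl

/-- The list of `exists_enumeration` can be started in such a way that a given linear form is
positive on `γ 1, …, γ k`. -/
theorem exists_enumeration_of_form [Nonempty T] {f : T → ℝ} {A B : ℝ}
    (hf : ∀ a, f a = A * R.x a + B * R.y a) (hne : ∀ a, f a ≠ 0) :
    ∃ (k : ℕ) (γ : ℤ → T), 0 < k ∧ Function.Surjective γ ∧
    (∀ t, γ (t + k) = R.neg (γ t)) ∧
    (∀ t j : ℤ, 0 < j → j < k → 0 < R.area (γ t) (γ (t + j))) ∧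
    (∀ σ : T → T, Function.Involutive σ → (∀ a b, R.area (σ a) (σ b) = -R.area a b) →
      ∀ s t, σ (γ t) = γ s → ∀ j, σ (γ (t + j)) = γ (s - j)) ∧
    ∀ i : ℤ, 0 < i → i ≤ k → 0 < f (γ i) := by
  obtain ⟨k, γ, hk, hsurj, hneg, harea, hσ⟩ := R.exists_enumeration
  obtain ⟨p, hp⟩ := exists_forall_pos hneg harea hf hne
  refine ⟨k, fun t => γ (p + t), hk, fun a => ?_, fun t => ?_, fun t j h1 h2 => ?_,
    fun σ h1 h2 s t hst j => ?_, fun i h1 h2 => hp _ (by omega) (by omega)⟩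
  · obtain ⟨t, ht⟩ := hsurj a
    exact ⟨t - p, by simpa using ht⟩
  · rw [← hneg, add_assoc]
  · change 0 < R.area (γ (p + t)) (γ (p + (t + j)))
    rw [← add_assoc]
    exact harea _ _ h1 h2
  · change σ (γ (p + (t + j))) = γ (p + (s - j))
    rw [← add_assoc, hσ σ h1 h2 _ _ hst, add_sub_assoc]

end PlanarRoots

/-! ### Dihedral groups and positions -/

/-- The rotation ρ = r (t + 1) * r t does not depend on t, so r t = ρ ^ t * r 0. -/
theorem mul_mul_eq_of_conj {G : Type*} [Group G] {r : ℤ → G} (hr : ∀ t, r t * r t = 1)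
    (hconj : ∀ s t, r s * r t * r s = r (2 * s - t)) (a b c : ℤ) :
    r a * r b * r c = r (a - b + c) := by
  have hstep : ∀ t : ℤ, r (t + 1) * r t = r t * r (t - 1) := by
    intro t
    have h := hconj t (t - 1)
    rw [show 2 * t - (t - 1) = t + 1 by ring] at h
    rw [← h, mul_assoc, hr, mul_one]
  have hrho : ∀ t : ℤ, r (t + 1) * r t = r 1 * r 0 := by
    intro t
    induction t using Int.induction_on with
    | zero => simp
    | succ n ih =>
      rw [hstep, add_sub_cancel_right, ih]
    | pred n ih =>
      rw [hstep] at ih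
      rw [sub_add_cancel, ih]
  have hsucc : ∀ t : ℤ, r (t + 1) = (r 1 * r 0) * r t := by
    intro t
    rw [← hrho t, mul_assoc, hr, mul_one]
  have hall : ∀ t : ℤ, r t = (r 1 * r 0) ^ t * r 0 := by
    intro t
    induction t using Int.induction_on with
    | zero => simp
    | succ n ih => rw [hsucc, ih, add_comm, zpow_add, zpow_one, mul_assoc (r 1 * r 0)]
    | pred n ih =>
      have h := hsucc (-n - 1)
      rw [sub_add_cancel, ih] at h
      rw [sub_eq_neg_add, zpow_add, zpow_neg_one, mul_assoc, h, inv_mul_cancel_left,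
        sub_eq_neg_add]
  have hab : r a * r b = (r 1 * r 0) ^ (a - b) := by
    have h : (r 1 * r 0) ^ (a - b) * r b = r a := by
      rw [hall b, ← mul_assoc, ← zpow_add, sub_add_cancel, ← hall]
    rw [← h, mul_assoc, hr, mul_one]
  rw [hab, hall c, ← mul_assoc, ← zpow_add, ← hall]

/-- The action of a dihedral group, whose reflections are `r t`, with `t` an integer modulo `k`,
on a group `G` with a height function `h`. Every element has a position modulo `2 k`, which a
reflection `r t` takes from `p` to `2 t - 1 - p`, and reflections towards the position `0`
increase the height. -/
structure DihedralPosition (G : Type*) [Group G] (h : G → ℤ) where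
  /-- the number of reflections -/
  k : ℕ
  /-- the reflections -/
  r : ℤ → G
  /-- `pos g p` says that `g` has position `p` -/
  pos : G → ℤ → Prop
  k_pos : 0 < k
  mul_self : ∀ t, r t * r t = 1
  periodic : ∀ t, r (t + k) = r t
  mul_mul : ∀ a b c, r a * r b * r c = r (a - b + c)
  exists_pos : ∀ g, ∃ p, pos g p
  pos_add : ∀ g p, pos g p → ∀ n : ℤ, pos g (p + n * (2 * k))
  pos_unique : ∀ g p q, pos g p → pos g q → p < q → p + 2 * k ≤ q
  pos_mul : ∀ g p t, pos g p → pos (g * r t) (2 * t - 1 - p)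
  lt_mul : ∀ g p t, pos g p → |p| ≤ k → |2 * t - 1 - p| < |p| → h g < h (g * r t)

namespace DihedralPosition

variable {G : Type*} [Group G] {h : G → ℤ} (D : DihedralPosition G h)

theorem periodic_mul (t n : ℤ) : D.r (t + n * D.k) = D.r t := by
  induction n using Int.induction_on with
  | zero => simp
  | succ n ih => rw [add_mul, one_mul, ← add_assoc, D.periodic, ih]
  | pred n ih =>
    rw [← D.periodic, add_assoc, ← add_one_mul, sub_add_cancel, ih]

theorem exists_pos_abs_le (g : G) : ∃ p, D.pos g p ∧ |p| ≤ D.k := by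
  obtain ⟨p, hp⟩ := D.exists_pos g
  have hk : (0 : ℤ) < 2 * D.k := by have := D.k_pos; omega
  refine ⟨_, D.pos_add g p hp (-((p + D.k) / (2 * D.k))), ?_⟩
  have h1 := Int.emod_nonneg (p + D.k) hk.ne'
  have h2 := Int.emod_lt_of_pos (p + D.k) hk
  rw [Int.emod_def] at h1 h2
  rw [abs_le]
  constructor <;> linarith

theorem exists_r_eq (p t : ℤ) : ∃ t', D.r t' = D.r t ∧ |2 * t' - 1 - p| ≤ D.k := by
  have hk : (0 : ℤ) < 2 * D.k := by have := D.k_pos; omega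
  refine ⟨_, D.periodic_mul t (-((2 * t - 1 - p + D.k) / (2 * D.k))), ?_⟩
  have h1 := Int.emod_nonneg (2 * t - 1 - p + D.k) hk.ne'
  have h2 := Int.emod_lt_of_pos (2 * t - 1 - p + D.k) hk
  rw [Int.emod_def] at h1 h2
  rw [abs_le]
  constructor <;> linarith

/-- A reflection away from 0 is undone by one towards 0, which would raise the height; a tie is
impossible because p and 2t - 1 - p have opposite parity. -/
theorem exists_of_lt {g : G} {p : ℤ} (hp : D.pos g p) (t : ℤ) (ht : h g < h (g * D.r t)) :
    ∃ t', D.r t' = D.r t ∧ |2 * t' - 1 - p| < |p| := by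
  obtain ⟨t', h1, h2⟩ := D.exists_r_eq p t
  refine ⟨t', h1, ?_⟩
  by_contra! hle
  have hne : |p| ≠ |2 * t' - 1 - p| := by
    intro heq
    rcases abs_eq_abs.1 heq with h3 | h3 <;> omega
  have h3 := D.lt_mul _ _ t' (D.pos_mul g p t' hp) h2 (by
    rw [show 2 * t' - 1 - (2 * t' - 1 - p) = p by ring]
    exact lt_of_le_of_ne hle hne)
  rw [mul_assoc, D.mul_self, mul_one, h1] at h3
  omega

/-- If there were a gap between the positions, three reflections would fit in between. -/
theorem exists_of_eq_add_one {g : G} {p : ℤ} (hp : D.pos g p) (hpk : |p| ≤ D.k) (t : ℤ)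
    (ht : h (g * D.r t) = h g + 1) :
    ∃ t', D.r t' = D.r t ∧ |2 * t' - 1 - p| = |p| - 1 := by
  obtain ⟨t', h1, h2⟩ := D.exists_of_lt hp t (by omega)
  refine ⟨t', h1, ?_⟩
  by_contra hne
  have h3 : |2 * t' - 1 - p| ≤ |p| - 3 := by
    rcases abs_cases p with ⟨e1, _⟩ | ⟨e1, _⟩ <;>
    rcases abs_cases (2 * t' - 1 - p) with ⟨e2, _⟩ | ⟨e2, _⟩ <;> omega
  have h0 := abs_nonneg (2 * t' - 1 - p)
  -- Three ascents, with positions p, |p| - 1, |p| - 2, 2t' - 1 - p, whose product is r t'.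
  obtain ⟨a, ha⟩ : ∃ a, 2 * a - 1 - p = |p| - 1 := by
    rcases abs_cases p with ⟨e1, _⟩ | ⟨e1, _⟩
    · exact ⟨p, by omega⟩
    · exact ⟨0, by omega⟩
  have s1 : h g < h (g * D.r a) := D.lt_mul g p a hp hpk (by
    rw [ha, abs_of_nonneg] <;> omega)
  have p1 := D.pos_mul g p a hp
  rw [ha] at p1
  have s2 : h (g * D.r a) < h (g * D.r a * D.r (|p| - 1)) := by
    have e : 2 * (|p| - 1) - 1 - (|p| - 1) = |p| - 2 := by ring
    refine D.lt_mul _ _ (|p| - 1) p1 ?_ ?_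
    · rw [abs_of_nonneg] <;> omega
    · rw [e, abs_of_nonneg (a := |p| - 2), abs_of_nonneg (a := |p| - 1)] <;> omega
  have p2 := D.pos_mul _ _ (|p| - 1) p1
  rw [show 2 * (|p| - 1) - 1 - (|p| - 1) = |p| - 2 by ring] at p2
  have s3 : h (g * D.r a * D.r (|p| - 1)) <
      h (g * D.r a * D.r (|p| - 1) * D.r (t' - a + (|p| - 1))) := by
    refine D.lt_mul _ _ _ p2 ?_ ?_
    · rw [abs_of_nonneg] <;> omega
    · rw [show 2 * (t' - a + (|p| - 1)) - 1 - (|p| - 2) = 2 * t' - 1 - p by omega,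
        abs_of_nonneg (a := |p| - 2)] <;> omega
  have heq : g * D.r a * D.r (|p| - 1) * D.r (t' - a + (|p| - 1)) = g * D.r t := by
    rw [mul_assoc g, mul_assoc g, D.mul_mul,
      show a - (|p| - 1) + (t' - a + (|p| - 1)) = t' by ring, h1]
  rw [heq] at s3
  omega

theorem setOf_between_eq_pair {y w : G} {t₁ t₂ : ℤ} (hw : w = y * D.r t₁ * D.r t₂)
    (h₁ : h (y * D.r t₁) = h y + 1) (h₂ : h w = h y + 2) :
    ∃ a b : G, a ≠ b ∧
      {z | ∃ t t', z = y * D.r t ∧ w = z * D.r t' ∧ h y < h z ∧ h z < h w} = {a, b} := by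
  obtain ⟨p, hp, hpk⟩ := D.exists_pos_abs_le y
  obtain ⟨u₁, hu₁, hq⟩ := D.exists_of_eq_add_one hp hpk t₁ h₁
  have hpos₁ := D.pos_mul y p u₁ hp
  obtain ⟨u₂, hu₂, hs⟩ := D.exists_of_eq_add_one hpos₁ (by omega) t₂ (by
    rw [hu₁, ← hw, h₁, h₂]; ring)
  rw [hq] at hs
  -- This gives |p| ≥ 2, so ±(|p| - 1) are distinct; they differ by less than 2k, hence also modulo
  -- 2k.
  have h0 := abs_nonneg (2 * u₂ - 1 - (2 * u₁ - 1 - p))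
  obtain ⟨a, ha⟩ : ∃ a, 2 * a - 1 - p = |p| - 1 := by
    rcases abs_cases p with ⟨e1, _⟩ | ⟨e1, _⟩
    · exact ⟨p, by omega⟩
    · exact ⟨0, by omega⟩
  obtain ⟨b, hb⟩ : ∃ b, 2 * b - 1 - p = 1 - |p| := by
    rcases abs_cases p with ⟨e1, _⟩ | ⟨e1, _⟩
    · exact ⟨1, by omega⟩
    · exact ⟨p + 1, by omega⟩
  have hmem : ∀ c, |2 * c - 1 - p| = |p| - 1 →
      ∃ t t', y * D.r c = y * D.r t ∧ w = y * D.r c * D.r t' ∧ h y < h (y * D.r c) ∧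
        h (y * D.r c) < h w := by
    intro c hc
    -- A product of three reflections is a reflection, so w is one reflection away from y * r c.
    have hwc : w = y * D.r c * D.r (c - u₁ + u₂) := by
      rw [← D.mul_mul, mul_assoc (D.r c), mul_assoc y, ← mul_assoc (D.r c), D.mul_self, one_mul,
        hw, hu₁, hu₂, mul_assoc]
    refine ⟨c, c - u₁ + u₂, rfl, hwc, D.lt_mul y p c hp hpk (by omega), ?_⟩
    rw [hwc]
    refine D.lt_mul _ _ _ (D.pos_mul y p c hp) (by omega) ?_
    rw [show 2 * (c - u₁ + u₂) - 1 - (2 * c - 1 - p) = 2 * u₂ - 1 - (2 * u₁ - 1 - p) by ring]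
    omega
  refine ⟨y * D.r a, y * D.r b, fun hab => ?_, ?_⟩
  · have h1 := D.pos_mul y p a hp
    have h2 := D.pos_mul y p b hp
    rw [hab, ha] at h1
    rw [hb] at h2
    have := D.pos_unique _ _ _ h2 h1 (by omega)
    omega
  · ext z
    constructor
    · rintro ⟨t, t', rfl, -, h3, h4⟩
      obtain ⟨u, hu, hup⟩ := D.exists_of_eq_add_one hp hpk t (by omega)
      rw [← hu]
      rcases abs_choice (2 * u - 1 - p) with e | e
      · obtain rfl : u = a := by omega
        exact Or.inl rfl
      · obtain rfl : u = b := by omega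
        exact Or.inr rfl
    · rintro (rfl | rfl)
      · exact hmem a (by rw [ha, abs_of_nonneg]; omega)
      · exact hmem b (by rw [hb, abs_of_nonpos] <;> omega)

end DihedralPosition

/-! ### Rank two subsystems through a point -/

section RankTwo

variable {ι M V : Type*} [AddCommGroup M] [Module ℝ M] [AddCommGroup V] [Module ℝ V]
  (P : RootPairing ι ℝ M V)

theorem exists_root'_eq_zero_and_eq_one [P.IsReduced] {i j : ι} (hij : j ≠ i)
    (hij' : j ≠ P.reflectionPerm i i) : ∃ u, P.root' i u = 0 ∧ P.root' j u = 1 := by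
  by_contra! h
  have key : ∀ w, P.root' j w = (P.pairing j i / 2) * P.root' i w := by
    intro w
    set u := w - (P.root' i w / 2) • P.coroot i with hu
    have h0 : P.root' i u = 0 := by
      simp only [hu, map_sub, map_smul, P.root'_coroot_eq_pairing, P.pairing_same, smul_eq_mul]
      ring
    have h1 : P.root' j u = 0 := by
      by_contra hne
      refine h ((P.root' j u)⁻¹ • u) ?_ ?_
      · rw [map_smul, h0, smul_zero]
      · rw [map_smul, smul_eq_mul, inv_mul_cancel₀ hne]
    simp only [hu, map_sub, map_smul, P.root'_coroot_eq_pairing, smul_eq_mul] at h1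
    linarith
  rcases eq_or_eq_neg_of_root'_eq_mul P key with h1 | h1
  · exact hij h1
  · exact hij' h1

/-- The indices of the roots in the plane spanned by two roots that take an integral value
at `e`. -/
def rankTwo (i j : ι) (e : V) : Set ι :=
  {l | (∃ c d : ℝ, ∀ v, P.root' l v = c * P.root' i v + d * P.root' j v) ∧
    ∃ n : ℤ, P.root' l e = n}

variable {P} {i j : ι} {e : V}

theorem reflectionPerm_mem_rankTwo [P.IsCrystallographic] {l l' : ι} (hl : l ∈ rankTwo P i j e)
    (hl' : l' ∈ rankTwo P i j e) : P.reflectionPerm l l' ∈ rankTwo P i j e := by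
  obtain ⟨⟨c, d, h⟩, n, hn⟩ := hl
  obtain ⟨⟨c', d', h'⟩, n', hn'⟩ := hl'
  obtain ⟨m, hm⟩ := exists_int_pairing P l' l
  refine ⟨⟨c' - m * c, d' - m * d, fun v => ?_⟩, n' - m * n, ?_⟩
  · rw [root'_reflectionPerm, h, h', hm]; ring
  · rw [root'_reflectionPerm, hn, hn', hm]; push_cast; ring

theorem root'_eq_of_mem_rankTwo {u₁ u₂ : V} (h₁ : P.root' i u₁ = 1) (h₂ : P.root' i u₂ = 0)
    (h₃ : P.root' j u₁ = 0) (h₄ : P.root' j u₂ = 1) {l : ι} (hl : l ∈ rankTwo P i j e) (v : V) :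
    P.root' l v = P.root' l u₁ * P.root' i v + P.root' l u₂ * P.root' j v := by
  obtain ⟨⟨c, d, h⟩, -⟩ := hl
  rw [h u₁, h u₂, h₁, h₂, h₃, h₄, h]
  ring

/-- The roots of a rank two subsystem, as vectors in the plane. -/
def planarRoots [P.IsReduced] [P.IsCrystallographic] {u₁ u₂ : V} (h₁ : P.root' i u₁ = 1)
    (h₂ : P.root' i u₂ = 0) (h₃ : P.root' j u₁ = 0) (h₄ : P.root' j u₂ = 1)
    (hi : i ∈ rankTwo P i j e) (hj : j ∈ rankTwo P i j e) : PlanarRoots (rankTwo P i j e) where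
  x l := P.root' l u₁
  y l := P.root' l u₂
  neg l := ⟨P.reflectionPerm l l, reflectionPerm_mem_rankTwo l.2 l.2⟩
  x_neg l := root'_neg P l u₁
  y_neg l := root'_neg P l u₂
  neg_neg l := Subtype.ext (neg_neg_index P l)
  eq_or_eq_neg := by
    rintro ⟨l, hl⟩ ⟨l', hl'⟩ h
    have e1 := root'_eq_of_mem_rankTwo h₁ h₂ h₃ h₄ hl
    have e2 := root'_eq_of_mem_rankTwo h₁ h₂ h₃ h₄ hl'
    have : ∃ c : ℝ, ∀ v, P.root' l' v = c * P.root' l v := by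
      by_cases hx : P.root' l u₁ = 0
      · by_cases hy : P.root' l u₂ = 0
        · obtain ⟨v, hv⟩ := exists_root'_ne_zero P l
          rw [e1, hx, hy] at hv
          simp at hv
        · refine ⟨P.root' l' u₂ / P.root' l u₂, fun v => ?_⟩
          rw [e1 v, e2 v]
          field_simp
          linear_combination -P.root' i v * h
      · refine ⟨P.root' l' u₁ / P.root' l u₁, fun v => ?_⟩
        rw [e1 v, e2 v]
        field_simp
        linear_combination P.root' j v * h
    obtain ⟨c, hc⟩ := this
    rcases eq_or_eq_neg_of_root'_eq_mul P hc with h5 | h5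
    · exact Or.inl (Subtype.ext h5)
    · exact Or.inr (Subtype.ext h5)
  exists_area_ne_zero := by
    rintro ⟨l, hl⟩
    by_contra! h
    have hx := h ⟨j, hj⟩
    have hy := h ⟨i, hi⟩
    simp only [h₁, h₂, h₃, h₄] at hx hy
    obtain ⟨v, hv⟩ := exists_root'_ne_zero P l
    apply hv
    rw [root'_eq_of_mem_rankTwo h₁ h₂ h₃ h₄ hl, show P.root' l u₁ = 0 by linarith,
      show P.root' l u₂ = 0 by linarith]
    ring

/-- All these reflections fix -e; centred there they are linear, and conjugation relations reduce to
linear ones. -/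
theorem affineReflection_apply_of_root'_eq {l : ι} {m : ℤ} (h : P.root' l e = m) (v : V) :
    (affineReflection P l m : V ≃ᵃ[ℝ] V) v = P.coreflection l (v + e) - e := by
  rw [affineReflection_apply, affRefl, RootPairing.coreflection_apply]
  have h1 : P.toLinearMap (P.root l) (v + e) = P.root' l v + m := by
    rw [← h, ← map_add]
  simp only [RootPairing.root'] at h1
  rw [h1]
  push_cast
  simp only [RootPairing.root']
  module

theorem coreflection_reflectionPerm (l l' : ι) :
    P.coreflection (P.reflectionPerm l l') =
      P.coreflection l * P.coreflection l' * P.coreflection l :=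
  P.flip.reflection_reflectionPerm

theorem affineReflection_conj {l l' : ι} {m m' n : ℤ} (h : P.root' l e = m)
    (h' : P.root' l' e = m') (hn : P.root' (P.reflectionPerm l l') e = n) :
    affineReflection P l m * affineReflection P l' m' * affineReflection P l m =
      affineReflection P (P.reflectionPerm l l') n := by
  apply Subtype.ext
  ext v
  simp only [Subgroup.coe_mul, AffineEquiv.mul_def, AffineEquiv.trans_apply,
    affineReflection_apply_of_root'_eq h, affineReflection_apply_of_root'_eq h',
    affineReflection_apply_of_root'_eq hn, coreflection_reflectionPerm, LinearEquiv.mul_apply,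
    sub_add_cancel]

theorem root'_affRefl_sub {l l' : ι} {m : ℤ} (h : P.root' l e = m) (v : V) :
    P.root' l' (affRefl P l m v - e) = P.root' (P.reflectionPerm l l') (v - e) := by
  rw [map_sub, map_sub, root'_affRefl', root'_reflectionPerm _ _ _ e, h]
  ring

/-- The reflections in the hyperplanes through the intersection of two hyperplanes form a dihedral
group acting on the affine Weyl group. -/
theorem exists_dihedralPosition [Finite ι] [P.IsReduced] [P.IsCrystallographic] {b : P.Base}
    {v₀ : V} (hv₀ : v₀ ∈ baseAlcove b) (hij : j ≠ i) (hij' : j ≠ P.reflectionPerm i i)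
    (hi : ∃ m : ℤ, P.root' i e = m) (hj : ∃ m : ℤ, P.root' j e = m) :
    ∃ D : DihedralPosition (affineWeylGroup P) (alcoveHeight b v₀),
      (∀ t, ∃ l m, D.r t = affineReflection P l m) ∧
      ∀ l ∈ rankTwo P i j e, ∀ m : ℤ, P.root' l e = m → ∃ t, D.r t = affineReflection P l m := by
  obtain ⟨u₂, h₂, h₄⟩ := exists_root'_eq_zero_and_eq_one P hij hij'
  obtain ⟨u₁, h₃, h₁⟩ := exists_root'_eq_zero_and_eq_one P hij.symm
    (fun h => hij' (by rw [h, neg_neg_index]))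
  have hi : i ∈ rankTwo P i j e := ⟨⟨1, 0, fun v => by ring⟩, hi⟩
  have hj : j ∈ rankTwo P i j e := ⟨⟨0, 1, fun v => by ring⟩, hj⟩
  let R := planarRoots h₁ h₂ h₃ h₄ hi hj
  have hform : ∀ (v : V) (l : rankTwo P i j e),
      P.root' l v = P.root' i v * R.x l + P.root' j v * R.y l := by
    intro v l
    rw [root'_eq_of_mem_rankTwo h₁ h₂ h₃ h₄ l.2 v]
    change _ = P.root' i v * P.root' l u₁ + P.root' j v * P.root' l u₂
    ring
  have hreg := isRegular_of_mem_baseAlcove hv₀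
  have : Nonempty (rankTwo P i j e) := ⟨⟨i, hi⟩⟩
  -- A root is positive exactly when it is positive at -v₀, so γ 1, …, γ k are the positive roots of
  -- the subsystem and position 0 is the top chamber.
  obtain ⟨k, γ, hk, hsurj, hneg, harea, hσ, hpos⟩ := R.exists_enumeration_of_form
    (hform (-v₀)) (fun l h => hreg l 0 (by rw [map_neg] at h; push_cast; linarith))
  choose lev hlev using fun t => (γ t).2.2
  have hγneg : ∀ t, ((γ (t + k)) : ι) = P.reflectionPerm (γ t) (γ t) := fun t =>
    congrArg Subtype.val (hneg t)
  have hlevneg : ∀ t, lev (t + k) = -lev t := by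
    intro t
    have h := hlev (t + k)
    rw [hγneg, root'_neg, hlev] at h
    exact_mod_cast h.symm
  have hvalneg : ∀ t v, P.root' (γ (t + k)) v = -P.root' (γ t) v := fun t v => by
    rw [hγneg, root'_neg]
  -- The reflection in γ s reverses orientation, hence reverses the list, and takes γ s to γ (s +
  -- k).
  have hrefl : ∀ s t, P.reflectionPerm (γ s) (γ t) = (γ (2 * s + k - t) : ι) := by
    intro s t
    let σ : rankTwo P i j e → rankTwo P i j e := fun l =>
      ⟨P.reflectionPerm (γ s) l, reflectionPerm_mem_rankTwo (γ s).2 l.2⟩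
    have hinv : Function.Involutive σ := fun l => Subtype.ext (P.reflectionPerm_self (γ s) l)
    have hanti : ∀ l l', R.area (σ l) (σ l') = -R.area l l' := by
      intro l l'
      have hp : ∀ l : rankTwo P i j e, P.pairing l (γ s) =
          P.root' l u₁ * P.pairing i (γ s) + P.root' l u₂ * P.pairing j (γ s) := fun l =>
        root'_eq_of_mem_rankTwo h₁ h₂ h₃ h₄ l.2 (P.coroot (γ s))
      have hs := hp (γ s)
      rw [P.pairing_same] at hs
      change P.root' (P.reflectionPerm (γ s) l) u₁ * P.root' (P.reflectionPerm (γ s) l') u₂ -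
        P.root' (P.reflectionPerm (γ s) l) u₂ * P.root' (P.reflectionPerm (γ s) l') u₁ =
        -(P.root' l u₁ * P.root' l' u₂ - P.root' l u₂ * P.root' l' u₁)
      simp only [root'_reflectionPerm, hp l, hp l']
      linear_combination (P.root' l u₁ * P.root' l' u₂ - P.root' l u₂ * P.root' l' u₁) * hs
    have h := hσ σ hinv hanti (s + k) s (hneg s).symm (t - s)
    rw [add_sub_cancel, show s + (k : ℤ) - (t - s) = 2 * s + k - t by ring] at h
    exact congrArg Subtype.val h
  have hper : ∀ t, affineReflection P (γ (t + k)) (lev (t + k)) =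
      affineReflection P (γ t) (lev t) := fun t => by
    rw [hlevneg, hγneg, affineReflection_neg]
  have hconj : ∀ s t, affineReflection P (γ s) (lev s) * affineReflection P (γ t) (lev t) *
      affineReflection P (γ s) (lev s) =
      affineReflection P (γ (2 * s - t)) (lev (2 * s - t)) := by
    intro s t
    have h := hlev (2 * s - t + k)
    rw [affineReflection_conj (hlev s) (hlev t) (n := lev (2 * s - t + k)), ← hper, hrefl,
      show 2 * s + (k : ℤ) - t = 2 * s - t + k by ring]
    rw [hrefl, show 2 * s + (k : ℤ) - t = 2 * s - t + k by ring, h]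
  have hne : ∀ (g : affineWeylGroup P) (l : rankTwo P i j e),
      P.root' l (act g v₀ - e) ≠ 0 := by
    intro g l h
    obtain ⟨n, hn⟩ := l.2.2
    rw [map_sub, hn] at h
    exact hreg.act g l n (by linarith)
  have hpos' : ∀ t : ℤ, 0 < t → t ≤ k → b.IsPos (γ t) := by
    intro t h1 h2
    have := hpos t h1 h2
    rw [map_neg] at this
    rw [isPos_iff_root'_neg hv₀]
    linarith
  refine ⟨{
    k := k
    r := fun t => affineReflection P (γ t) (lev t)
    pos := fun g p => ∀ t, p < t → t ≤ p + k → 0 < P.root' (γ t) (act g v₀ - e)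
    k_pos := hk
    mul_self := fun t => affineReflection_mul_self _ _
    periodic := hper
    mul_mul := mul_mul_eq_of_conj (r := fun t => affineReflection P (γ t) (lev t))
      (fun t => affineReflection_mul_self _ _) hconj
    exists_pos := fun g => R.exists_forall_pos hneg harea (hform (act g v₀ - e)) (hne g)
    pos_add := ?_
    pos_unique := ?_
    pos_mul := ?_
    lt_mul := ?_ }, fun t => ⟨_, _, rfl⟩, ?_⟩
  · have hγ : ∀ t n : ℤ, γ (t + n * (2 * k)) = γ t := by
      have h2 : ∀ t : ℤ, γ (t + 2 * k) = γ t := fun t => by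
        rw [two_mul, ← add_assoc, hneg, hneg, R.neg_neg]
      intro t n
      induction n using Int.induction_on with
      | zero => simp
      | succ n ih => rw [add_mul, one_mul, ← add_assoc, h2, ih]
      | pred n ih => rw [← h2, add_assoc, ← add_one_mul, sub_add_cancel, ih]
    intro g p hp n t h1 h2
    have h3 := hp (t - n * (2 * k)) (by linarith) (by linarith)
    rwa [← hγ _ n, sub_add_cancel] at h3
  · intro g p q hp hq hpq
    by_contra! hlt
    rcases le_or_gt q (p + k) with h | h
    · have h1 := hp (p + 1) (by omega) (by omega)
      have h2 := hq (p + 1 + k) (by omega) (by omega)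
      rw [hvalneg] at h2
      linarith
    · have h1 := hp (q + 1 - k) (by omega) (by omega)
      have h2 := hq (q + 1 - k + k) (by omega) (by omega)
      rw [hvalneg] at h2
      linarith
  · intro g p s hp t h1 h2
    rw [act_mul_affineReflection, root'_affRefl_sub (hlev s), hrefl]
    exact hp _ (by omega) (by omega)
  · intro g p t hp hpk hlt
    -- For p ≥ 0 the bounds give 0 < t ≤ p ≤ k, and γ t is a positive root that is negative on the
    -- chamber. For p < 0 they give p < t ≤ 0, and -γ t = γ (t + k) is such a root. Either way the
    -- reflection goes up.
    rcases abs_cases p with ⟨e1, e2⟩ | ⟨e1, e2⟩ <;>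
    rcases abs_cases (2 * t - 1 - p) with ⟨e3, e4⟩ | ⟨e3, e4⟩ <;>
    rw [e1] at hpk hlt <;> rw [e3] at hlt
    iterate 2
      have h1 := hp (t + k) (by omega) (by omega)
      rw [hvalneg, map_sub, hlev] at h1
      exact alcoveHeight_lt_mul_affineReflection hv₀ g (hpos' t (by omega) (by omega))
        (by linarith)
    iterate 2
      have h1 := hp t (by omega) (by omega)
      rw [map_sub, hlev] at h1
      rw [← hper]
      refine alcoveHeight_lt_mul_affineReflection hv₀ g (hpos' (t + k) (by omega) (by omega)) ?_
      rw [hvalneg, hlevneg]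
      push_cast
      linarith
  · intro l hl m hm
    obtain ⟨t, ht⟩ := hsurj ⟨l, hl⟩
    refine ⟨t, ?_⟩
    have h1 : (γ t : ι) = l := congrArg Subtype.val ht
    have h2 := hlev t
    rw [h1, hm] at h2
    have h3 : lev t = m := by exact_mod_cast h2.symm
    simp only [h1, h3]

end RankTwo

/-! ### Counting the elements of an interval of length two -/

section Intervals

variable {ι M V : Type*} [AddCommGroup M] [Module ℝ M] [AddCommGroup V] [Module ℝ V]
  {P : RootPairing ι ℝ M V}

theorem affineReflection_neg' (i : ι) (m : ℤ) :
    affineReflection P (P.reflectionPerm i i) m = affineReflection P i (-m) := by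
  rw [← affineReflection_neg i (-m), neg_neg]

theorem cl_mul_affineReflection (y : affineWeylGroup P) (i : ι) (m : ℤ) (v : V) :
    cl (y * affineReflection P i m) v = cl y (P.coreflection i v) := rfl

theorem coreflection_neg (i : ι) : P.coreflection (P.reflectionPerm i i) = P.coreflection i := by
  ext v
  rw [coreflection_reflectionPerm]
  simp [LinearEquiv.mul_apply]

/-- Equality means s_α = s_β; composing with β gives -β = β - ⟨β, α^∨⟩α, so the roots are
proportional. -/
theorem cl_eq_cl_mul_mul_iff [P.IsReduced] (y : affineWeylGroup P) (i j : ι) (m n : ℤ) :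
    cl y = cl (y * affineReflection P i m * affineReflection P j n) ↔
      j = i ∨ j = P.reflectionPerm i i := by
  constructor
  · intro h
    have h1 : ∀ v, P.coreflection i (P.coreflection j v) = v := by
      intro v
      apply (cl y).injective
      rw [← cl_mul_affineReflection y i m, ← cl_mul_affineReflection _ j n, ← h]
    have h2 : ∀ v, P.root' j v = (P.pairing j i / 2) * P.root' i v := by
      intro v
      have h3 : P.coreflection j v = P.coreflection i v := by
        have := congrArg (P.coreflection i) (h1 v)
        simpa using this
      have h4 := congrArg (P.root' j) h3
      rw [root'_coreflection, root'_coreflection, root'_reflectionPerm, root'_reflectionPerm,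
        P.pairing_same] at h4
      linarith
    exact eq_or_eq_neg_of_root'_eq_mul P h2
  · rintro (rfl | rfl)
    · ext v
      rw [cl_mul_affineReflection, cl_mul_affineReflection]
      simp
    · ext v
      rw [cl_mul_affineReflection, cl_mul_affineReflection, coreflection_neg]
      simp

theorem eq_or_eq_neg_of_smul_coroot_eq [Finite ι] [P.IsReduced] {i j : ι} {a c : ℝ} (ha : a ≠ 0)
    (h : a • P.coroot i = c • P.coroot j) : j = i ∨ j = P.reflectionPerm i i := by
  let _ : Module ℚ M := Module.compHom M (algebraMap ℚ ℝ)
  let _ : Module ℚ V := Module.compHom V (algebraMap ℚ ℝ)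
  have : IsAddTorsionFree M := .of_module_rat M
  have : IsAddTorsionFree V := .of_module_rat V
  have h1 : P.coroot i = (c / a) • P.coroot j := by
    rw [div_eq_inv_mul, mul_smul, ← h, smul_smul, inv_mul_cancel₀ ha, one_smul]
  rw [P.coroot_eq_smul_coroot_iff] at h1
  refine eq_or_eq_neg_of_root'_eq_mul P (c := c / a) fun v => ?_
  simp [RootPairing.root', h1]

theorem eq_zero_and_eq_zero_of_smul_coroot_eq [Finite ι] [P.IsReduced] {i j : ι} {a c : ℝ}
    (hij : ¬ (j = i ∨ j = P.reflectionPerm i i))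
    (h : a • P.coroot i = c • P.coroot j) : a = 0 ∧ c = 0 := by
  have ha : a = 0 := by
    by_contra ha
    exact hij (eq_or_eq_neg_of_smul_coroot_eq ha h)
  refine ⟨ha, ?_⟩
  rw [ha, zero_smul] at h
  have := congrArg (P.root' j) h
  rw [map_zero, map_smul, P.root'_coroot_eq_pairing, P.pairing_same, smul_eq_mul] at this
  linarith

theorem affRefl_affRefl_eq_add (i : ι) (m n : ℤ) (v : V) :
    affRefl P i n (affRefl P i m v) = v + ((n : ℝ) - m) • P.coroot i := by
  rw [affRefl, root'_affRefl, P.pairing_same, affRefl]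
  module

/-- If two products of two reflections agree, the four hyperplanes contain a common subspace of
codimension two. -/
theorem mem_rankTwo_of_mul_eq_mul [Finite ι] [P.IsReduced] {i j i' j' : ι} {m n m' n' : ℤ}
    (hij' : ¬ (j' = i' ∨ j' = P.reflectionPerm i' i')) {u₁ u₂ e : V}
    (h₁ : P.root' i u₁ = 1) (h₂ : P.root' i u₂ = 0) (h₃ : P.root' j u₁ = 0)
    (h₄ : P.root' j u₂ = 1) (hie : P.root' i e = m) (hje : P.root' j e = n)
    (h : affineReflection P i m * affineReflection P j n =
      affineReflection P i' m' * affineReflection P j' n') :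
    (i' ∈ rankTwo P i j e ∧ P.root' i' e = m') ∧ (j' ∈ rankTwo P i j e ∧ P.root' j' e = n') := by
  -- If the second product fixes v, its two reflections move v by the same vector. This is a
  -- multiple of two independent coroots, hence zero.
  have fixed : ∀ v, P.root' i v = m → P.root' j v = n → P.root' i' v = m' ∧ P.root' j' v = n' := by
    intro v hi hj
    have h1 := congrArg (fun g => act g v) h
    simp only [act_mul, act_affineReflection] at h1
    have h2 : affRefl P j n (affRefl P i m v) = v := by
      have h3 : affRefl P i m v = v := by rw [affRefl, hi, sub_self, zero_smul, sub_zero]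
      rw [h3, affRefl, hj, sub_self, zero_smul, sub_zero]
    rw [h2] at h1
    have h3 := congrArg (affRefl P j' n') h1
    rw [affRefl_affRefl, affRefl, affRefl, sub_right_inj] at h3
    obtain ⟨h4, h5⟩ := eq_zero_and_eq_zero_of_smul_coroot_eq hij' h3.symm
    exact ⟨sub_eq_zero.1 h4, sub_eq_zero.1 h5⟩
  obtain ⟨hi'e, hj'e⟩ := fixed e hie hje
  -- The new forms are constant on the intersection, so they combine the old ones; the test point is
  -- e plus the part of v killed by both old forms.
  have span : ∀ v, P.root' i' v = P.root' i' u₁ * P.root' i v + P.root' i' u₂ * P.root' j v ∧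
      P.root' j' v = P.root' j' u₁ * P.root' i v + P.root' j' u₂ * P.root' j v := by
    intro v
    obtain ⟨h5, h6⟩ := fixed (e + (v - P.root' i v • u₁ - P.root' j v • u₂))
      (by simp [h₁, h₂, hie]) (by simp [h₃, h₄, hje])
    simp only [map_add, map_sub, map_smul, smul_eq_mul, hi'e, hj'e] at h5 h6
    constructor <;> linarith
  exact ⟨⟨⟨⟨_, _, fun v => (span v).1⟩, m', hi'e⟩, hi'e⟩,
    ⟨⟨⟨_, _, fun v => (span v).2⟩, n', hj'e⟩, hj'e⟩⟩

variable [Finite ι] [P.IsCrystallographic]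

/-- The level m enters each integral part only through the integer m⟨β, α^∨⟩, so the height of the
reflected point is affine in m. -/
theorem floorSum_affRefl_sub_floorSum_affRefl (b : P.Base) (i : ι) (m n : ℤ) (v : V) :
    floorSum b (affRefl P i n v) - floorSum b (affRefl P i m v) =
      (n - m) * ∑ j ∈ posRoots b, P.pairingIn ℤ j i := by
  simp only [floorSum, floor_affRefl, Finset.sum_add_distrib, ← Finset.mul_sum]
  ring

theorem setOf_ascends_eq_singleton [P.IsReduced] {b : P.Base} {v₀ : V}
    {y w : affineWeylGroup P}
    (hw : alcoveHeight b v₀ w = alcoveHeight b v₀ y + 2) (hcl : cl y = cl w)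
    {z : affineWeylGroup P} (hyz : Ascends b v₀ y z) (hzw : Ascends b v₀ z w) :
    {z | Ascends b v₀ y z ∧ Ascends b v₀ z w} = {z} := by
  have form : ∀ z, Ascends b v₀ y z → Ascends b v₀ z w → ∃ i m n,
      z = y * affineReflection P i m ∧
      w = y * affineReflection P i m * affineReflection P i n := by
    rintro _ ⟨⟨i, m, rfl⟩, -⟩ ⟨⟨j, n, rfl⟩, -⟩
    rcases (cl_eq_cl_mul_mul_iff y i j m n).1 hcl with rfl | rfl
    · exact ⟨j, m, n, rfl, rfl⟩
    · exact ⟨i, m, -n, rfl, by rw [affineReflection_neg']⟩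
  refine Set.eq_singleton_iff_unique_mem.2 ⟨⟨hyz, hzw⟩, ?_⟩
  rintro z' ⟨hyz', hzw'⟩
  have hz : alcoveHeight b v₀ z = alcoveHeight b v₀ z' := by
    have := hyz.2
    have := hyz'.2
    have := hzw.2
    have := hzw'.2
    omega
  obtain ⟨i, m, n, rfl, hwi⟩ := form z hyz hzw
  obtain ⟨i', m', n', rfl, hwi'⟩ := form z' hyz' hzw'
  have hslope : ((n : ℤ) - m) * ∑ j ∈ posRoots b, P.pairingIn ℤ j i = 2 := by
    rw [← floorSum_affRefl_sub_floorSum_affRefl b i m n (affRefl P i m (act y v₀)),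
      affRefl_affRefl]
    rw [hwi, alcoveHeight, act_mul_affineReflection, act_mul_affineReflection,
      alcoveHeight] at hw
    omega
  have hnm : ((n : ℝ) - m) ≠ 0 := by
    intro h
    have h' : n - m = 0 := by exact_mod_cast h
    rw [h', zero_mul] at hslope
    omega
  -- Both chains end at w, so they translate v₀ · y by the same vector.
  have hco : ((n : ℝ) - m) • P.coroot i = ((n' : ℝ) - m') • P.coroot i' := by
    have h1 := congrArg (fun g => act g v₀) (hwi.symm.trans hwi')
    simp only [act_mul_affineReflection, affRefl_affRefl_eq_add] at h1
    exact add_left_cancel h1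
  obtain ⟨k, hk⟩ : ∃ k, affineReflection P i' m' = affineReflection P i k := by
    rcases eq_or_eq_neg_of_smul_coroot_eq hnm hco with rfl | rfl
    · exact ⟨m', rfl⟩
    · exact ⟨-m', affineReflection_neg' i m'⟩
  rw [hk] at hz ⊢
  rw [alcoveHeight, alcoveHeight, act_mul_affineReflection, act_mul_affineReflection] at hz
  have h2 := floorSum_affRefl_sub_floorSum_affRefl b i m k (act y v₀)
  rw [hz, sub_self, eq_comm, mul_eq_zero] at h2
  rcases h2 with h2 | h2
  · rw [show k = m by omega]
  · rw [h2, mul_zero] at hslope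
    omega

theorem exists_setOf_ascends_eq_pair [P.IsReduced] {b : P.Base} {v₀ : V}
    (hv₀ : v₀ ∈ baseAlcove b) {y w : affineWeylGroup P}
    (hw : alcoveHeight b v₀ w = alcoveHeight b v₀ y + 2) (hcl : cl y ≠ cl w)
    {z : affineWeylGroup P} (hyz : Ascends b v₀ y z) (hzw : Ascends b v₀ z w) :
    ∃ z₁ z₂, z₁ ≠ z₂ ∧ {z | Ascends b v₀ y z ∧ Ascends b v₀ z w} = {z₁, z₂} := by
  obtain ⟨⟨i, m, hz⟩, hyz'⟩ := hyz
  obtain ⟨⟨j, n, hwz⟩, hzw'⟩ := hzw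
  have hw' : w = y * affineReflection P i m * affineReflection P j n := by rw [hwz, hz]
  have hij : ¬ (j = i ∨ j = P.reflectionPerm i i) := by
    rw [← cl_eq_cl_mul_mul_iff y i j m n, ← hw']
    exact hcl
  obtain ⟨hji, hji'⟩ := not_or.1 hij
  obtain ⟨u₂, h₂, h₄⟩ := exists_root'_eq_zero_and_eq_one P hji hji'
  obtain ⟨u₁, h₃, h₁⟩ := exists_root'_eq_zero_and_eq_one P (Ne.symm hji)
    (fun h => hji' (by rw [h, neg_neg_index]))
  set e : V := (m : ℝ) • u₁ + (n : ℝ) • u₂ with he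
  have hie : P.root' i e = m := by simp [he, h₁, h₂]
  have hje : P.root' j e = n := by simp [he, h₃, h₄]
  obtain ⟨D, hD, hD'⟩ := exists_dihedralPosition hv₀ hji hji' ⟨m, hie⟩ ⟨n, hje⟩
  obtain ⟨t₁, ht₁⟩ := hD' i ⟨⟨1, 0, fun v => by ring⟩, m, hie⟩ m hie
  obtain ⟨t₂, ht₂⟩ := hD' j ⟨⟨0, 1, fun v => by ring⟩, n, hje⟩ n hje
  obtain ⟨z₁, z₂, hne, heq⟩ := D.setOf_between_eq_pair (y := y) (w := w) (t₁ := t₁) (t₂ := t₂)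
    (by rw [ht₁, ht₂, hw']) (by rw [ht₁, ← hz]; omega) hw
  refine ⟨z₁, z₂, hne, ?_⟩
  rw [← heq]
  ext x
  constructor
  · rintro ⟨⟨⟨i', m', hx⟩, hyx⟩, ⟨j', n', hwx⟩, hxw⟩
    rw [hx] at hwx
    have hij' : ¬ (j' = i' ∨ j' = P.reflectionPerm i' i') := by
      rw [← cl_eq_cl_mul_mul_iff y i' j' m' n', ← hwx]
      exact hcl
    have hmul : affineReflection P i m * affineReflection P j n =
        affineReflection P i' m' * affineReflection P j' n' := by
      rw [hw', mul_assoc, mul_assoc] at hwx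
      exact mul_left_cancel hwx
    obtain ⟨⟨hi', hi'e⟩, hj', hj'e⟩ :=
      mem_rankTwo_of_mul_eq_mul hij' h₁ h₂ h₃ h₄ hie hje hmul
    obtain ⟨t, ht⟩ := hD' i' hi' m' hi'e
    obtain ⟨t', ht'⟩ := hD' j' hj' n' hj'e
    exact ⟨t, t', by rw [ht, hx], by rw [ht', hwx, hx], hyx, hxw⟩
  · rintro ⟨t, t', hx, hwx, hyx, hxw⟩
    obtain ⟨l, p, hl⟩ := hD t
    obtain ⟨l', p', hl'⟩ := hD t'
    exact ⟨⟨⟨l, p, by rw [hx, hl]⟩, hyx⟩, ⟨l', p', by rw [hwx, hl']⟩, hxw⟩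

end Intervals

end SemiInfinite

theorem proposition2p2p3 {ι M V : Type*} [Finite ι]
    [AddCommGroup M] [Module ℝ M] [AddCommGroup V] [Module ℝ V]
    [TopologicalSpace V] [IsTopologicalAddGroup V] [ContinuousSMul ℝ V] [T2Space V]
    (P : RootPairing ι ℝ M V) [P.IsRootSystem] [P.IsCrystallographic] [P.IsReduced]
    [P.IsIrreducible] (b : P.Base)
    (y w : SemiInfinite.affineWeylGroup P)
    (hlen : SemiInfinite.semiInfLength b y w = 2)
    (hle : SemiInfinite.semiInfLE b y w) :
    (SemiInfinite.cl y = SemiInfinite.cl w →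
      {z : SemiInfinite.affineWeylGroup P |
        SemiInfinite.semiInfLT b y z ∧ SemiInfinite.semiInfLT b z w}.ncard = 1) ∧
    (SemiInfinite.cl y ≠ SemiInfinite.cl w →
      {z : SemiInfinite.affineWeylGroup P |
        SemiInfinite.semiInfLT b y z ∧ SemiInfinite.semiInfLT b z w}.ncard = 2) := by
  -- A point of A⁻ comes from the length being nonzero: a gallery then starts at A⁻ · y, which is
  -- therefore nonempty.
  obtain ⟨v₀, hv₀⟩ := SemiInfinite.baseAlcove_nonempty_of_semiInfLength_ne_zero (b := b) (y := y)
    (w := w) (by rw [hlen]; norm_num)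
  have hw : SemiInfinite.alcoveHeight b v₀ w = SemiInfinite.alcoveHeight b v₀ y + 2 := by
    rw [SemiInfinite.semiInfLength_eq_alcoveHeight_sub hv₀] at hlen
    omega
  rw [SemiInfinite.setOf_semiInfLT_eq hv₀ hw]
  obtain ⟨z, hyz, hzw⟩ := SemiInfinite.exists_ascends_ascends hv₀ hw hle
  refine ⟨fun hcl => ?_, fun hcl => ?_⟩
  · rw [SemiInfinite.setOf_ascends_eq_singleton hw hcl hyz hzw, Set.ncard_singleton]
  · obtain ⟨z₁, z₂, hne, heq⟩ :=
      SemiInfinite.exists_setOf_ascends_eq_pair hv₀ hw hcl hyz hzw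
    rw [heq, Set.ncard_pair hne]
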